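/- Fix an integer $m>2$ and write $S^{m-1}$ for the unit sphere in $\mathbf R^m$. Consider the one-dimensional wave map problem $$-\phi_{tt}+\phi_{xx}+\phi\,\bigl(|\phi_x|^2-|\phi_t|^2\bigr)=0,\qquad \phi(0)=f,\quad \phi_t(0)=0,\qquad f:\mathbf R\to S^{m-1}. \tag{1}$$ For bounded $f$ let $\hat f$ be the distributional Fourier transform restricted to $\{\xi\neq0\}$ (so constants have norm zero), and put $$\|f\|_{\dot H^{1/2}}=\Bigl(\int|\xi|\,|\hat f(\xi)|^2\,d\xi\Bigr)^{1/2},\qquad \|f\|_{\dot B^{1/2,1}_2}=\sum_{j\in\mathbf Z}2^{j/2}\Bigl(\int_{2^j\le|\xi|<2^{j+1}}|\hat f(\xi)|^2\,d\xi\Bigr)^{1/2},$$ these being $\infty$ if $\hat f$ is not a locally integrable function on $\{\xi\ne0\}$. For $X=\dot H^{1/2}$ or $X=\dot B^{1/2,1}_2$ let $d_X(f,g)=\|f-g\|_X+\|f-g\|_{L^2([-1,1])}$. Say that (1) is *well-posed for small data in $X$* if there are $\delta,T>0$ and an operator $S$, defined on all measurable $f:\mathbf R\to S^{m-1}$ with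 $\|f\|_X<\delta$, such that: $S(f)$ is a $d_X$-continuous curve on $[0,T]$ of (almost everywhere) $S^{m-1}$-valued functions of finite $X$ norm, with $S(f)(0)=f$; for each such $f$ and each $\eta>0$ there is $\rho>0$ such that $\sup_{t\in[0,T]}d_X(S(f')(t),S(f)(t))\le\eta$ whenever $d_X(f',f)<\rho$; and $S(f)$ is the classical ($C^2$) solution of (1) on $[0,T]\times\mathbf R$ whenever $f$ is smooth and constant outside a bounded set and such a solution exists. Then: 1. (1) is not well-posed for small data in $\dot H^{1/2}$. 2. (1) is not well-posed for small data in $\dot B^{1/2,1}_2$. 3. For every $\varepsilon>0$ there is a smooth $f:\mathbf R\to S^{m-1}$ with $\|f\|_{\dot B^{1/2,1}_2}\le\varepsilon$ and $\|f\|_{\dot H^{1/2}}\le\varepsilon$ that cannot be continued for any non-zero time in $\dot B^{1/2,1}_2$, or even in $\dot H^{1/2}$: (1) has a smooth $S^{m-1}$-valued solution on $(-\tau,\tau)\times\mathbf R$ for some $\tau>0$, and for every nondegenerate time interval $I\ni0$ and every $C^2$ solution $\phi$ of (1) on $I\times\mathbf R$ one has $\|\phi(t)\|_{\dot H^{1/2}}=\|\phi(t)\|_{\dot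 B^{1/2,1}_2}=\infty$ for all $t\in I\setminus\{0\}$. -/

import Mathlib

open MeasureTheory Filter Topology Set
open scoped ENNReal ContDiff FourierTransform SchwartzMap

noncomputable section

/-- The ambient Euclidean space of the sphere `S^{m-1}`. -/
abbrev Amb (m : ℕ) : Type := EuclideanSpace ℝ (Fin m)

/-- `g` represents, away from the frequency `ξ = 0`, the distributional Fourier transform
`∫ f(x) e^{-2πixξ} dx` of the bounded measurable function `f`. Ignoring the frequency `0` is what
gives constant functions the norm zero below; since `f` is bounded, constants are the only
functions whose Fourier transform lives at `0`. -/
structure IsFourierOffZero {m : ℕ} (f : ℝ → Amb m) (g : ℝ → EuclideanSpace ℂ (Fin m)) : Prop where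
  bounded : MemLp f ⊤ volume
  locallyIntegrable : LocallyIntegrableOn g {0}ᶜ volume
  pairing : ∀ ψ : 𝓢(ℝ, ℂ), HasCompactSupport ψ → (0 : ℝ) ∉ tsupport ψ →
    ∀ i : Fin m, ∫ x, (f x i : ℂ) * (𝓕 ψ) x = ∫ ξ, g ξ i * ψ ξ

/-- The homogeneous Sobolev norm `(∫ |ξ|^{2s} |f̂(ξ)|² dξ)^{1/2}` of a bounded function, constants
having norm zero. It is `∞` when `f̂` is not a locally integrable function away from `0`, the
infimum being over the empty set; otherwise `g` is unique almost everywhere. -/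
def hDotNorm {m : ℕ} (s : ℝ) (f : ℝ → Amb m) : ℝ≥0∞ :=
  ⨅ (g : ℝ → EuclideanSpace ℂ (Fin m)) (_ : IsFourierOffZero f g),
    (∫⁻ ξ, ENNReal.ofReal (|ξ| ^ (2 * s)) * ‖g ξ‖ₑ ^ 2) ^ (1 / 2 : ℝ)

/-- The homogeneous Besov norm of `Ḃ^{s,1}_2`,
`∑_j 2^{js} (∫_{2^j ≤ |ξ| < 2^{j+1}} |f̂(ξ)|² dξ)^{1/2}`, with the same conventions. -/
def besovNorm {m : ℕ} (s : ℝ) (f : ℝ → Amb m) : ℝ≥0∞ :=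
  ⨅ (g : ℝ → EuclideanSpace ℂ (Fin m)) (_ : IsFourierOffZero f g),
    ∑' j : ℤ, ENNReal.ofReal ((2 : ℝ) ^ ((j : ℝ) * s)) *
      (∫⁻ ξ in {ξ : ℝ | (2 : ℝ) ^ j ≤ |ξ| ∧ |ξ| < (2 : ℝ) ^ (j + 1)}, ‖g ξ‖ₑ ^ 2) ^ (1 / 2 : ℝ)

/-- `φ` is a classical (`C²`) solution on `I × ℝ`, where `I` is a time interval containing `0`, of
`□φ + φ (∂_μ φ · ∂^μ φ) = 0`, `φ(0) = f`, `φ_t(0) = 0`, for the metric `diag(-1, 1)`.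
Time derivatives are one-sided at an endpoint of `I`. -/
structure IsWaveMapOn {m : ℕ} (I : Set ℝ) (f : ℝ → Amb m) (φ : ℝ → ℝ → Amb m) : Prop where
  contDiffOn : ContDiffOn ℝ 2 (fun p : ℝ × ℝ => φ p.1 p.2) (I ×ˢ univ)
  equation : ∀ t ∈ I, ∀ x : ℝ,
    (-iteratedDerivWithin 2 (fun r => φ r x) I t + iteratedDeriv 2 (φ t) x) +
      (-‖derivWithin (fun r => φ r x) I t‖ ^ 2 + ‖deriv (φ t) x‖ ^ 2) • φ t x = 0
  position : φ 0 = f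
  velocity : ∀ x : ℝ, derivWithin (fun r => φ r x) I 0 = 0

/-- The distance in which data and solutions are compared: a homogeneous norm `N`, which does not
see constants, plus the `L²` norm on a fixed bounded interval, which does. -/
def critDist {m : ℕ} (N : (ℝ → Amb m) → ℝ≥0∞) (f g : ℝ → Amb m) : ℝ≥0∞ :=
  N (f - g) + eLpNorm (f - g) 2 (volume.restrict (Icc (-1) 1))

/-- Data with values in the unit sphere and with norm less than `δ`. -/
def smallData {m : ℕ} (N : (ℝ → Amb m) → ℝ≥0∞) (δ : ℝ≥0∞) : Set (ℝ → Amb m) :=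
  {f | Measurable f ∧ (∀ x, ‖f x‖ = 1) ∧ N f < δ}

/-- The Cauchy problem for wave maps `ℝ^{1+1} → S^{m-1}` with zero initial velocity is (locally)
well-posed for small data in the space with norm `N`: for some `δ, T > 0` there is a solution
operator `S` on the data of norm less than `δ`, taking values in the continuous sphere-valued
curves `[0,T] → N`-space, that depends continuously on the data and gives the classical solution
for smooth data that are constant outside a bounded set. -/
def SmallDataWellPosed (m : ℕ) (N : (ℝ → Amb m) → ℝ≥0∞) : Prop :=
  ∃ δ : ℝ≥0∞, 0 < δ ∧ ∃ T : ℝ, 0 < T ∧ ∃ S : (ℝ → Amb m) → ℝ → ℝ → Amb m,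
    (∀ f ∈ smallData N δ,
      S f 0 =ᵐ[volume] f ∧
      (∀ t ∈ Icc 0 T, AEStronglyMeasurable (S f t) volume ∧ (∀ᵐ x, ‖S f t x‖ = 1) ∧
        N (S f t) < ⊤) ∧
      (∀ t ∈ Icc 0 T, Tendsto (fun r => critDist N (S f r) (S f t)) (𝓝[Icc 0 T] t) (𝓝 0))) ∧
    (∀ f ∈ smallData N δ, ∀ η : ℝ≥0∞, 0 < η → ∃ ρ : ℝ≥0∞, 0 < ρ ∧
      ∀ f' ∈ smallData N δ, critDist N f' f < ρ →
        ∀ t ∈ Icc 0 T, critDist N (S f' t) (S f t) ≤ η) ∧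
    (∀ f ∈ smallData N δ, ContDiff ℝ ∞ f →
      (∃ (R : ℝ) (c : Amb m), ∀ x, R ≤ |x| → f x = c) →
      ∀ φ : ℝ → ℝ → Amb m, IsWaveMapOn (Icc 0 T) f φ →
        ∀ t ∈ Icc 0 T, S f t =ᵐ[volume] φ t)

end

/-!
The equation is conformally invariant: changing the null coordinates `x + t` and `x - t` by one
and the same function turns solutions with zero initial velocity into such solutions. For `0 < κ <
1` there is a solution `(τ, σ) ↦ (s τ cos σ, s τ sin σ, d τ)` in which `(s, d)` swings along the
unit circle like a pendulum (Jacobi elliptic functions) and which at `τ = 0` is a circle of radius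
`κ`. Composing with a phase that increases from `0` to `2π` in an interval of length `2⁻ⁿ` gives a
wave map whose data leave a constant `c` only to run once around this small circle
(`exists_bump_waveMap`, which rotates the sphere so that `c` is the same for all `κ`). When the
two waves emitted by the bump have separated, the solution between them is the point `(τ, σ) = (π,
π)` of the surface. It would be `c` if the period of the pendulum were `2π`, but the period is
longer because the amplitude is not zero, so between the waves the solution is a constant
different from `c`.

The Besov norm of the data is at most a constant times `κ`, for every `n`, since the norm is
invariant under dyadic dilations (`exists_besovNorm_superposition_le`). At a fixed positive time
the solution makes a jump of fixed height at scale `2⁻ⁿ`, and its `Ḣ^{1/2}` norm is at least of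
order `√n`: testing against dilates of one profile with Fourier support in a dyadic band shows
that each of the dyadic scales between `2⁻ⁿ` and `1` contributes equally to the square of the norm
(`exists_le_hDotNorm_of_jump`). Hence small `κ` and then large `n` contradict continuity of the
solution operator at the constant `c`, in either norm (`not_smallDataWellPosed`).

For the instantaneous blow-up, bumps with summable amplitudes and quickly decreasing widths are
put at the points `4^(k+1)`. By uniqueness in backward cones (`eq_zero_of_wave_inequality`,
applied to the difference of two solutions in `IsForwardWaveMap.eq_of_eventuallyEq`), at any fixed
time every `C²` solution with these data is, near all but finitely many of the bumps, the explicit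
solution emitted by that bump alone. Each of these bumps bounds the norm from below, and the
bounds tend to infinity (`exists_instant_blowup`).
-/

/-! ### Jacobi elliptic functions -/

theorem ellipticRadicand_pos {k : ℝ} (hk : 0 < k) (hk1 : k < 1) (x : ℝ) :
    0 < 1 - k ^ 2 * Real.sin x ^ 2 := by
  have h1 := Real.sin_sq_le_one x
  nlinarith [mul_le_mul_of_nonneg_left h1 (sq_nonneg k)]

/-- The Jacobi amplitude, normalised to take the value `π / 2` at `0`. It is the inverse function
of the incomplete elliptic integral of the first kind; the complete integral exceeds `π / 2`, so the
amplitude gains less than `π` over the interval `[0, π]`. -/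
theorem exists_amplitude {k : ℝ} (hk : 0 < k) (hk1 : k < 1) :
    ∃ am : ℝ → ℝ, ContDiff ℝ ∞ am ∧
      (∀ t, HasDerivAt am (√(1 - k ^ 2 * Real.sin (am t) ^ 2)) t) ∧
      am 0 = Real.pi / 2 ∧ Real.pi / 2 < am Real.pi ∧ am Real.pi < 3 * Real.pi / 2 := by
  set h : ℝ → ℝ := fun x => √(1 - k ^ 2 * Real.sin x ^ 2) with hh
  have hpos : ∀ x, 0 < h x := fun x => Real.sqrt_pos.2 (ellipticRadicand_pos hk hk1 x)
  have hle : ∀ x, h x ≤ 1 := fun x => by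
    rw [hh]; apply Real.sqrt_le_one.2
    nlinarith [mul_nonneg (sq_nonneg k) (sq_nonneg (Real.sin x))]
  have hsm : ContDiff ℝ ∞ h := by
    apply ContDiff.sqrt
    · fun_prop
    · exact fun x => (ellipticRadicand_pos hk hk1 x).ne'
  have hism : ContDiff ℝ ∞ (fun x => (h x)⁻¹) := hsm.inv fun x => (hpos x).ne'
  set E : ℝ → ℝ := fun x => ∫ y in (Real.pi / 2)..x, (h y)⁻¹ with hE
  have hEd : ∀ x, HasDerivAt E (h x)⁻¹ x := fun x =>
    intervalIntegral.integral_hasDerivAt_right (hism.continuous.intervalIntegrable _ _)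
      hism.continuous.stronglyMeasurable.stronglyMeasurableAtFilter hism.continuous.continuousAt
  have hEsm : ContDiff ℝ ∞ E := by
    rw [contDiff_infty_iff_deriv]
    refine ⟨fun x => (hEd x).differentiableAt, ?_⟩
    rwa [show deriv E = fun x => (h x)⁻¹ from funext fun x => (hEd x).deriv]
  have hEmono : StrictMono E := strictMono_of_deriv_pos fun x => by
    rw [(hEd x).deriv]; exact inv_pos.2 (hpos x)
  have hE0 : E (Real.pi / 2) = 0 := by simp [hE]
  -- `E` grows at least as fast as the identity
  have hmono : Monotone (fun x => E x - x) := by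
    apply monotone_of_deriv_nonneg
    · exact fun x => ((hEd x).sub (hasDerivAt_id x)).differentiableAt
    · intro x
      have hx : HasDerivAt (fun x => E x - x) ((h x)⁻¹ - 1) x := (hEd x).sub (hasDerivAt_id x)
      rw [hx.deriv]
      exact sub_nonneg.2 ((one_le_inv₀ (hpos x)).2 (hle x))
  have hsurj : Function.Surjective E := by
    apply Continuous.surjective hEsm.continuous
    · refine tendsto_atTop_mono' atTop ?_
        (tendsto_atTop_add_const_right atTop (-(Real.pi/2)) tendsto_id)
      filter_upwards [eventually_ge_atTop (Real.pi / 2)] with x hx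
      have := hmono hx
      simp only [hE0, id] at this ⊢
      linarith
    · refine tendsto_atBot_mono' atBot ?_
        (tendsto_atBot_add_const_right atBot (-(Real.pi/2)) tendsto_id)
      filter_upwards [eventually_le_atBot (Real.pi / 2)] with x hx
      have := hmono hx
      simp only [hE0, id] at this ⊢
      linarith
  let e : ℝ ≃ₜ ℝ := (hEmono.orderIsoOfSurjective E hsurj).toHomeomorph
  have heE : ∀ x, e x = E x := fun x => rfl
  have hEe : ∀ t, E (e.symm t) = t := fun t => by rw [← heE]; exact e.apply_symm_apply t
  have heE' : ∀ x, e.symm (E x) = x := fun x => by rw [← heE]; exact e.symm_apply_apply x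
  have hval : e.symm 0 = Real.pi / 2 := by rw [← hE0, heE']
  have hsmono : StrictMono e.symm := fun x y hxy => by
    rw [← hEmono.lt_iff_lt, hEe, hEe]; exact hxy
  refine ⟨e.symm, ?_, ?_, hval, ?_, ?_⟩
  · rw [contDiff_iff_contDiffAt]
    intro t
    exact e.toOpenPartialHomeomorph.contDiffAt_symm_deriv (f₀' := (h (e.symm t))⁻¹)
      (inv_pos.2 (hpos _)).ne' (by simp) (hEd _) hEsm.contDiffAt
  · intro t
    have := HasDerivAt.of_local_left_inverse (f := E) (g := e.symm) e.symm.continuous.continuousAt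
      (hEd _) (inv_pos.2 (hpos _)).ne' (Eventually.of_forall hEe) (a := t)
    rwa [inv_inv] at this
  · rw [← hval]; exact hsmono Real.pi_pos
  · rw [← hEmono.lt_iff_lt, hEe]
    have hlt : ∫ _ in (Real.pi / 2)..(3 * Real.pi / 2), (1 : ℝ) < E (3 * Real.pi / 2) := by
      apply intervalIntegral.integral_lt_integral_of_continuousOn_of_le_of_exists_lt
      · linarith [Real.pi_pos]
      · exact continuousOn_const
      · exact hism.continuous.continuousOn
      · exact fun x _ => (one_le_inv₀ (hpos x)).2 (hle x)
      · refine ⟨Real.pi / 2, ⟨le_rfl, by linarith [Real.pi_pos]⟩, ?_⟩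
        rw [one_lt_inv₀ (hpos _), hh]
        simp only [Real.sin_pi_div_two]
        rw [Real.sqrt_lt' one_pos]
        nlinarith
    simp at hlt
    linarith

/-- The functions `s = k sin am`, `c = k cos am`, `d = √(1 - k² sin² am)` of the Jacobi amplitude.
The point `(s, d)` moves along the unit circle as a pendulum would, and after time `π` it has not
yet reached `(-k, d 0)`: the period of a pendulum exceeds the period of its linearisation. -/
theorem exists_jacobi {k : ℝ} (hk : 0 < k) (hk1 : k < 1) :
    ∃ s c d : ℝ → ℝ, ContDiff ℝ ∞ s ∧ ContDiff ℝ ∞ d ∧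
      (∀ t, HasDerivAt s (c t * d t) t) ∧ (∀ t, HasDerivAt c (-(s t * d t)) t) ∧
      (∀ t, HasDerivAt d (-(s t * c t)) t) ∧ (∀ t, s t ^ 2 + d t ^ 2 = 1) ∧
      s 0 = k ∧ c 0 = 0 ∧ d 0 = √(1 - k ^ 2) ∧
      √(1 - k ^ 2) * d Real.pi - k * s Real.pi < 1 := by
  obtain ⟨am, hsm, hd, h0, hl, hu⟩ := exists_amplitude hk hk1
  have hrad := fun t => ellipticRadicand_pos hk hk1 (am t)
  have hs : ∀ t, HasDerivAt (fun t => k * Real.sin (am t))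
      (k * Real.cos (am t) * √(1 - k ^ 2 * Real.sin (am t) ^ 2)) t := fun t =>
    ((hd t).sin.const_mul k).congr_deriv (by ring)
  refine ⟨fun t => k * Real.sin (am t), fun t => k * Real.cos (am t),
    fun t => √(1 - k ^ 2 * Real.sin (am t) ^ 2), by fun_prop, ?_, hs, ?_, ?_, ?_, ?_, ?_, ?_, ?_⟩
  · exact ContDiff.sqrt (by fun_prop) fun t => (hrad t).ne'
  · exact fun t => ((hd t).cos.const_mul k).congr_deriv (by ring)
  · intro t
    have h1 : HasDerivAt (fun t => 1 - k ^ 2 * Real.sin (am t) ^ 2)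
        (-(2 * (k * Real.sin (am t)) *
          (k * Real.cos (am t) * √(1 - k ^ 2 * Real.sin (am t) ^ 2)))) t := by
      have hsin := (((hd t).sin.pow 2).const_mul (k ^ 2)).const_sub 1
      exact hsin.congr_deriv (by push_cast; ring)
    refine (h1.sqrt (hrad t).ne').congr_deriv ?_
    have := (Real.sqrt_pos.2 (hrad t)).ne'
    field_simp
  · intro t
    simp only
    rw [Real.sq_sqrt (hrad t).le]; ring
  · simp [h0]
  · simp [h0]
  · simp [h0]
  · set S := Real.sin (am Real.pi) with hS
    have hS1 : -1 < S := by
      have : 0 < Real.cos ((am Real.pi - Real.pi / 2) / 2) :=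
        Real.cos_pos_of_mem_Ioo ⟨by linarith, by linarith⟩
      have h2 : S = 2 * Real.cos ((am Real.pi - Real.pi / 2) / 2) ^ 2 - 1 := by
        rw [← Real.cos_two_mul, hS, ← Real.cos_sub_pi_div_two]; ring_nf
      rw [h2]; nlinarith [pow_pos this 2]
    have hk2 : 0 < 1 - k ^ 2 := by nlinarith
    have ha := Real.sq_sqrt hk2.le
    have hb := Real.sq_sqrt (hrad Real.pi).le
    -- twice the deficit is the squared distance from `(s, d)` to `(-k, d 0)`
    simp only
    nlinarith [sq_nonneg (√(1 - k ^ 2) - √(1 - k ^ 2 * S ^ 2)), pow_pos (show 0 < k * (1 + S) by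
      apply mul_pos hk; linarith) 2]

/-! ### An explicit family of wave maps -/

/-- A function all of whose derivatives up to order two exist everywhere and which satisfies the
wave map equation everywhere is a classical solution on every time set with unique derivatives. -/
theorem isWaveMapOn_of_hasDerivAt {m : ℕ} {φ φt φx φtt φxx : ℝ → ℝ → Amb m}
    (hφ : ContDiff ℝ ∞ (fun p : ℝ × ℝ => φ p.1 p.2))
    (ht : ∀ t x, HasDerivAt (fun r => φ r x) (φt t x) t)
    (hx : ∀ t x, HasDerivAt (φ t) (φx t x) x)
    (htt : ∀ t x, HasDerivAt (fun r => φt r x) (φtt t x) t)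
    (hxx : ∀ t x, HasDerivAt (φx t) (φxx t x) x)
    (heq : ∀ t x, (-φtt t x + φxx t x) + (-‖φt t x‖ ^ 2 + ‖φx t x‖ ^ 2) • φ t x = 0)
    (h0 : ∀ x, φt 0 x = 0) {I : Set ℝ} (hI : UniqueDiffOn ℝ I) (h0I : (0 : ℝ) ∈ I) :
    IsWaveMapOn I (φ 0) φ := by
  have ht' : ∀ x, deriv (fun r => φ r x) = fun r => φt r x := fun x =>
    funext fun t => (ht t x).deriv
  have hx' : ∀ t, deriv (φ t) = φx t := fun t => funext fun x => (hx t x).deriv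
  have hW : ∀ t ∈ I, ∀ x, derivWithin (fun r => φ r x) I t = φt t x := fun t htI x =>
    (ht t x).hasDerivWithinAt.derivWithin (hI t htI)
  refine ⟨(contDiff_infty.1 hφ 2).contDiffOn, fun t htI x => ?_, rfl,
    fun x => by rw [hW 0 h0I, h0]⟩
  have hsm : ContDiff ℝ ∞ (fun r => φ r x) :=
    hφ.comp (contDiff_id.prodMk contDiff_const)
  have h2 : iteratedDerivWithin 2 (fun r => φ r x) I t = φtt t x := by
    rw [iteratedDerivWithin_eq_iteratedDeriv hI
      (contDiff_infty.1 hsm 2).contDiffAt htI, iteratedDeriv_succ,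
      iteratedDeriv_one, ht', (htt t x).deriv]
  have h3 : iteratedDeriv 2 (φ t) x = φxx t x := by
    rw [iteratedDeriv_succ, iteratedDeriv_one, hx', (hxx t x).deriv]
  rw [h2, h3, hW t htI, hx', heq]

/-- The vector with coordinates `X`, `Y`, `Z` in the frame `e`. -/
noncomputable def frameComb {m : ℕ} (e : Fin 3 → Amb m) (X Y Z : ℝ) : Amb m :=
  X • e 0 + Y • e 1 + Z • e 2

theorem norm_frameComb_sq {m : ℕ} {e : Fin 3 → Amb m} (he : Orthonormal ℝ e) (X Y Z : ℝ) :
    ‖frameComb e X Y Z‖ ^ 2 = X ^ 2 + Y ^ 2 + Z ^ 2 := by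
  have h := orthonormal_iff_ite.1 he
  rw [← real_inner_self_eq_norm_sq]
  simp only [frameComb, inner_add_left, inner_add_right, inner_smul_left, inner_smul_right, h]
  simp
  ring

theorem HasDerivAt.frameComb {m : ℕ} (e : Fin 3 → Amb m) {X Y Z : ℝ → ℝ} {X' Y' Z' r : ℝ}
    (hX : HasDerivAt X X' r) (hY : HasDerivAt Y Y' r) (hZ : HasDerivAt Z Z' r) :
    HasDerivAt (fun r => frameComb e (X r) (Y r) (Z r)) (frameComb e X' Y' Z') r :=
  ((hX.smul_const (e 0)).add (hY.smul_const (e 1))).add (hZ.smul_const (e 2))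

/-- The wave map obtained from the surface of revolution
`(τ, σ) ↦ (s τ cos σ, s τ sin σ, d τ)` in the frame `e` by the conformal change of the null
coordinates `x + t ↦ a (x + t)`, `x - t ↦ a (x - t)`. -/
noncomputable def revolutionMap {m : ℕ} (e : Fin 3 → Amb m) (s d a : ℝ → ℝ) (t x : ℝ) : Amb m :=
  frameComb e
    (s ((a (x + t) - a (x - t)) / 2) * Real.cos ((a (x + t) + a (x - t)) / 2))
    (s ((a (x + t) - a (x - t)) / 2) * Real.sin ((a (x + t) + a (x - t)) / 2))
    (d ((a (x + t) - a (x - t)) / 2))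

section Revolution

variable {s c d : ℝ → ℝ} (hs : ∀ t, HasDerivAt s (c t * d t) t)
  (hc : ∀ t, HasDerivAt c (-(s t * d t)) t) (hd : ∀ t, HasDerivAt d (-(s t * c t)) t)

include hs hd in
theorem hasDerivAt_revolution {m : ℕ} (e : Fin 3 → Amb m) {τ σ : ℝ → ℝ} {τ' σ' r : ℝ}
    (hτ : HasDerivAt τ τ' r) (hσ : HasDerivAt σ σ' r) :
    HasDerivAt (fun r => frameComb e (s (τ r) * Real.cos (σ r))
        (s (τ r) * Real.sin (σ r)) (d (τ r)))
      (frameComb e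
        (c (τ r) * d (τ r) * τ' * Real.cos (σ r) - s (τ r) * Real.sin (σ r) * σ')
        (c (τ r) * d (τ r) * τ' * Real.sin (σ r) + s (τ r) * Real.cos (σ r) * σ')
        (-(s (τ r) * c (τ r)) * τ')) r := by
  have h1 : HasDerivAt (fun r => s (τ r)) _ r := (hs (τ r)).comp r hτ
  have h2 : HasDerivAt (fun r => d (τ r)) _ r := (hd (τ r)).comp r hτ
  exact HasDerivAt.frameComb e ((h1.mul hσ.cos).congr_deriv (by ring))
    ((h1.mul hσ.sin).congr_deriv (by ring)) h2

include hs hc hd in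
theorem hasDerivAt_revolution_deriv {m : ℕ} (e : Fin 3 → Amb m) {τ σ τ' σ' : ℝ → ℝ}
    {τ'' σ'' r : ℝ} (hτ : HasDerivAt τ (τ' r) r) (hσ : HasDerivAt σ (σ' r) r)
    (hτ' : HasDerivAt τ' τ'' r) (hσ' : HasDerivAt σ' σ'' r) :
    HasDerivAt (fun r => frameComb e
        (c (τ r) * d (τ r) * τ' r * Real.cos (σ r) - s (τ r) * Real.sin (σ r) * σ' r)
        (c (τ r) * d (τ r) * τ' r * Real.sin (σ r) + s (τ r) * Real.cos (σ r) * σ' r)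
        (-(s (τ r) * c (τ r)) * τ' r))
      (frameComb e
        (-(s (τ r) * (c (τ r) ^ 2 + d (τ r) ^ 2)) * τ' r ^ 2 * Real.cos (σ r)
          + c (τ r) * d (τ r) * τ'' * Real.cos (σ r)
          - 2 * (c (τ r) * d (τ r) * τ' r * Real.sin (σ r) * σ' r)
          - s (τ r) * Real.cos (σ r) * σ' r ^ 2 - s (τ r) * Real.sin (σ r) * σ'')
        (-(s (τ r) * (c (τ r) ^ 2 + d (τ r) ^ 2)) * τ' r ^ 2 * Real.sin (σ r)
          + c (τ r) * d (τ r) * τ'' * Real.sin (σ r)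
          + 2 * (c (τ r) * d (τ r) * τ' r * Real.cos (σ r) * σ' r)
          - s (τ r) * Real.sin (σ r) * σ' r ^ 2 + s (τ r) * Real.cos (σ r) * σ'')
        (-(c (τ r) ^ 2 * d (τ r) - s (τ r) ^ 2 * d (τ r)) * τ' r ^ 2
          - s (τ r) * c (τ r) * τ'')) r := by
  have h1 : HasDerivAt (fun r => s (τ r)) _ r := (hs (τ r)).comp r hτ
  have h2 : HasDerivAt (fun r => d (τ r)) _ r := (hd (τ r)).comp r hτ
  have h3 : HasDerivAt (fun r => c (τ r)) _ r := (hc (τ r)).comp r hτ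
  refine HasDerivAt.frameComb e ?_ ?_ ?_
  · exact ((((h3.mul h2).mul hτ').mul hσ.cos).sub ((h1.mul hσ.sin).mul hσ')).congr_deriv
      (by simp only [Pi.mul_apply]; ring)
  · exact ((((h3.mul h2).mul hτ').mul hσ.sin).add ((h1.mul hσ.cos).mul hσ')).congr_deriv
      (by simp only [Pi.mul_apply]; ring)
  · exact ((h1.mul h3).neg.mul hτ').congr_deriv
      (by simp only [Pi.mul_apply, Pi.neg_apply]; ring)

theorem contDiff_revolutionMap {m : ℕ} (e : Fin 3 → Amb m) {a : ℝ → ℝ} (hsm : ContDiff ℝ ∞ s)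
    (hdm : ContDiff ℝ ∞ d) (ha : ContDiff ℝ ∞ a) :
    ContDiff ℝ ∞ (fun p : ℝ × ℝ => revolutionMap e s d a p.1 p.2) := by
  unfold revolutionMap frameComb
  fun_prop

theorem norm_revolutionMap {m : ℕ} {e : Fin 3 → Amb m} (he : Orthonormal ℝ e)
    (hsd : ∀ t, s t ^ 2 + d t ^ 2 = 1) (a : ℝ → ℝ) (t x : ℝ) :
    ‖revolutionMap e s d a t x‖ = 1 := by
  have h : ‖revolutionMap e s d a t x‖ ^ 2 = 1 := by
    rw [revolutionMap, norm_frameComb_sq he]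
    linear_combination hsd ((a (x + t) - a (x - t)) / 2)
      + s ((a (x + t) - a (x - t)) / 2) ^ 2 * Real.sin_sq_add_cos_sq ((a (x + t) + a (x - t)) / 2)
  exact (pow_eq_one_iff_of_nonneg (norm_nonneg _) two_ne_zero).1 h

include hs hc hd in
/-- For the surface of revolution itself the wave map equation is the second order differential
equation for `s` and `d` that follows from the first order system; a conformal change of the null
coordinates preserves it. The initial velocity vanishes because `c 0 = 0`. -/
theorem isWaveMapOn_revolutionMap {m : ℕ} {e : Fin 3 → Amb m} (he : Orthonormal ℝ e)
    (hsm : ContDiff ℝ ∞ s) (hdm : ContDiff ℝ ∞ d) (hsd : ∀ t, s t ^ 2 + d t ^ 2 = 1)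
    (hc0 : c 0 = 0) {a : ℝ → ℝ} (ha : ContDiff ℝ ∞ a) {I : Set ℝ} (hI : UniqueDiffOn ℝ I)
    (h0I : (0 : ℝ) ∈ I) :
    IsWaveMapOn I (revolutionMap e s d a 0) (revolutionMap e s d a) := by
  have ha1 : ∀ y, HasDerivAt a (deriv a y) y := fun y =>
    (ha.differentiable (by simp) y).hasDerivAt
  have ha2 : ∀ y, HasDerivAt (deriv a) (deriv (deriv a) y) y := fun y =>
    ((contDiff_infty_iff_deriv.1 ha).2.differentiable (by simp) y).hasDerivAt
  -- derivatives of a function of `x + t` or `x - t` in either variable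
  have hpt : ∀ (f f' : ℝ → ℝ), (∀ y, HasDerivAt f (f' y) y) → ∀ t x : ℝ,
      HasDerivAt (fun r => f (x + r)) (f' (x + t)) t := fun f f' hf t x =>
    ((hf (x + t)).comp t ((hasDerivAt_id t).const_add x)).congr_deriv (by simp)
  have hmt : ∀ (f f' : ℝ → ℝ), (∀ y, HasDerivAt f (f' y) y) → ∀ t x : ℝ,
      HasDerivAt (fun r => f (x - r)) (-f' (x - t)) t := fun f f' hf t x =>
    ((hf (x - t)).comp t ((hasDerivAt_id t).const_sub x)).congr_deriv (by simp)
  have hpx : ∀ (f f' : ℝ → ℝ), (∀ y, HasDerivAt f (f' y) y) → ∀ t x : ℝ,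
      HasDerivAt (fun y => f (y + t)) (f' (x + t)) x := fun f f' hf t x =>
    ((hf (x + t)).comp x ((hasDerivAt_id x).add_const t)).congr_deriv (by simp)
  have hmx : ∀ (f f' : ℝ → ℝ), (∀ y, HasDerivAt f (f' y) y) → ∀ t x : ℝ,
      HasDerivAt (fun y => f (y - t)) (f' (x - t)) x := fun f f' hf t x =>
    ((hf (x - t)).comp x ((hasDerivAt_id x).sub_const t)).congr_deriv (by simp)
  have tt : ∀ t x, HasDerivAt (fun r => (a (x + r) - a (x - r)) / 2)
      ((deriv a (x + t) + deriv a (x - t)) / 2) t := fun t x =>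
    (((hpt _ _ ha1 t x).sub (hmt _ _ ha1 t x)).div_const 2).congr_deriv (by ring)
  have st : ∀ t x, HasDerivAt (fun r => (a (x + r) + a (x - r)) / 2)
      ((deriv a (x + t) - deriv a (x - t)) / 2) t := fun t x =>
    (((hpt _ _ ha1 t x).add (hmt _ _ ha1 t x)).div_const 2).congr_deriv (by ring)
  have tx : ∀ t x, HasDerivAt (fun y => (a (y + t) - a (y - t)) / 2)
      ((deriv a (x + t) - deriv a (x - t)) / 2) x := fun t x =>
    ((hpx _ _ ha1 t x).sub (hmx _ _ ha1 t x)).div_const 2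
  have sx : ∀ t x, HasDerivAt (fun y => (a (y + t) + a (y - t)) / 2)
      ((deriv a (x + t) + deriv a (x - t)) / 2) x := fun t x =>
    ((hpx _ _ ha1 t x).add (hmx _ _ ha1 t x)).div_const 2
  have ttt : ∀ t x, HasDerivAt (fun r => (deriv a (x + r) + deriv a (x - r)) / 2)
      ((deriv (deriv a) (x + t) - deriv (deriv a) (x - t)) / 2) t := fun t x =>
    (((hpt _ _ ha2 t x).add (hmt _ _ ha2 t x)).div_const 2).congr_deriv (by ring)
  have stt : ∀ t x, HasDerivAt (fun r => (deriv a (x + r) - deriv a (x - r)) / 2)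
      ((deriv (deriv a) (x + t) + deriv (deriv a) (x - t)) / 2) t := fun t x =>
    (((hpt _ _ ha2 t x).sub (hmt _ _ ha2 t x)).div_const 2).congr_deriv (by ring)
  have txx : ∀ t x, HasDerivAt (fun y => (deriv a (y + t) - deriv a (y - t)) / 2)
      ((deriv (deriv a) (x + t) - deriv (deriv a) (x - t)) / 2) x := fun t x =>
    ((hpx _ _ ha2 t x).sub (hmx _ _ ha2 t x)).div_const 2
  have sxx : ∀ t x, HasDerivAt (fun y => (deriv a (y + t) + deriv a (y - t)) / 2)
      ((deriv (deriv a) (x + t) + deriv (deriv a) (x - t)) / 2) x := fun t x =>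
    ((hpx _ _ ha2 t x).add (hmx _ _ ha2 t x)).div_const 2
  refine isWaveMapOn_of_hasDerivAt (contDiff_revolutionMap e hsm hdm ha)
    (fun t x => hasDerivAt_revolution hs hd e (tt t x) (st t x))
    (fun t x => hasDerivAt_revolution hs hd e (tx t x) (sx t x))
    (fun t x => hasDerivAt_revolution_deriv hs hc hd e (tt t x) (st t x) (ttt t x) (stt t x))
    (fun t x => hasDerivAt_revolution_deriv hs hc hd e (tx t x) (sx t x) (txx t x) (sxx t x))
    (fun t x => ?_) (fun x => ?_) hI h0I
  · rw [norm_frameComb_sq he, norm_frameComb_sq he]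
    simp only [revolutionMap]
    generalize (a (x + t) - a (x - t)) / 2 = τ
    generalize (a (x + t) + a (x - t)) / 2 = σ
    generalize deriv a (x + t) = p
    generalize deriv a (x - t) = q
    have h1 := hsd τ
    have h2 := Real.sin_sq_add_cos_sq σ
    -- the metric of the surface is `c² dτ² + s² dσ²`
    have hL : ∀ A B : ℝ, (c τ * d τ * A * Real.cos σ - s τ * Real.sin σ * B) ^ 2
        + (c τ * d τ * A * Real.sin σ + s τ * Real.cos σ * B) ^ 2 + (-(s τ * c τ) * A) ^ 2
        = c τ ^ 2 * A ^ 2 + s τ ^ 2 * B ^ 2 := fun A B => by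
      linear_combination (c τ ^ 2 * d τ ^ 2 * A ^ 2 + s τ ^ 2 * B ^ 2) * h2 + c τ ^ 2 * A ^ 2 * h1
    rw [hL, hL]
    have hd2 : d τ ^ 2 = 1 - s τ ^ 2 := by linarith
    simp only [frameComb, hd2]
    module
  · have : (a (x + 0) - a (x - 0)) / 2 = 0 := by simp
    simp only [this, hc0]
    simp [frameComb]

end Revolution

/-! ### Uniqueness in a domain of dependence -/

/-- A curve starting at `0` whose speed is at most `K e^{λ r}` is at distance at most
`(K / λ) e^{λ r}` from `0`. Only derivatives in the open interval enter. -/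
theorem norm_le_of_norm_deriv_le_exp {E : Type*} [NormedAddCommGroup E] [InnerProductSpace ℝ E]
    {h h' : ℝ → E} {s K l : ℝ} (hs : 0 ≤ s) (hl : 0 < l) (hK : 0 ≤ K)
    (hcont : ContinuousOn h (Icc 0 s)) (hderiv : ∀ r ∈ Ioo 0 s, HasDerivAt h (h' r) r)
    (hbound : ∀ r ∈ Ioo 0 s, ‖h' r‖ ≤ K * Real.exp (l * r)) (h0 : h 0 = 0) :
    ‖h s‖ ≤ K / l * Real.exp (l * s) := by
  -- test against the direction `v` of `h s`, so that only scalar monotonicity is needed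
  set v : E := (‖h s‖)⁻¹ • h s with hv
  have hv1 : ‖v‖ ≤ 1 := by
    rw [hv, norm_smul, norm_inv, norm_norm]; exact inv_mul_le_one
  have hder : ∀ r ∈ Ioo 0 s, HasDerivAt (fun r => inner ℝ v (h r) - K / l * Real.exp (l * r))
      (inner ℝ v (h' r) - K * Real.exp (l * r)) r := fun r hr => by
    have h1 : HasDerivAt (fun r => inner ℝ v (h r)) (inner ℝ v (h' r)) r :=
      (innerSL ℝ v).hasFDerivAt.comp_hasDerivAt r (hderiv r hr)
    have h2 : HasDerivAt (fun r => Real.exp (l * r)) (Real.exp (l * r) * (l * 1)) r :=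
      ((hasDerivAt_id r).const_mul l).exp
    refine (h1.sub (h2.const_mul (K / l))).congr_deriv ?_
    field_simp
  have hanti : AntitoneOn (fun r => inner ℝ v (h r) - K / l * Real.exp (l * r)) (Icc 0 s) := by
    apply antitoneOn_of_deriv_nonpos (convex_Icc 0 s)
    · exact (continuousOn_const.inner hcont).sub (by fun_prop)
    · rw [interior_Icc]
      exact fun r hr => (hder r hr).differentiableAt.differentiableWithinAt
    · rw [interior_Icc]
      intro r hr
      rw [(hder r hr).deriv]
      have := real_inner_le_norm v (h' r)
      have h3 := hbound r hr
      nlinarith [norm_nonneg (h' r), mul_le_mul_of_nonneg_right hv1 (norm_nonneg (h' r))]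
  have h1 := hanti ⟨le_rfl, hs⟩ ⟨hs, le_rfl⟩ hs
  have h2 : inner ℝ v (h s) = ‖h s‖ := by
    rw [hv, real_inner_smul_left, real_inner_self_eq_norm_sq]
    by_cases h0 : ‖h s‖ = 0
    · simp [h0]
    · field_simp
  simp only [h2, h0, inner_zero_right, mul_zero, Real.exp_zero, mul_one] at h1
  have : 0 ≤ K / l := div_nonneg hK hl.le
  linarith

/-- Finite speed of propagation for wave inequalities: if `‖□W‖ ≤ C (‖W‖ + ‖∂W‖)` in the
truncated backward cone `|x - x₀| ≤ R - t`, and `W` and its first derivatives vanish on the base,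
then `W = 0` in the cone. The derivatives of `W` along the two null directions are integrated along
the characteristics; at a point of the cone where the maximum of
`e^{-λt} (‖W‖ + ‖W_t + W_x‖ + ‖W_t - W_x‖)` is attained, this bounds the maximum by half of
itself once `λ` is large. -/
theorem eq_zero_of_wave_inequality {E : Type*} [NormedAddCommGroup E] [InnerProductSpace ℝ E]
    {W : ℝ × ℝ → E} {T R x₀ C : ℝ} (hT : 0 < T) (hC : 0 ≤ C)
    (hW : ContDiffOn ℝ 2 W (Icc 0 T ×ˢ univ))
    (hineq : ∀ t ∈ Ioo 0 T, ∀ x, |x - x₀| ≤ R - t →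
      ‖fderiv ℝ (fderiv ℝ W) (t, x) (1, 0) (1, 0) - fderiv ℝ (fderiv ℝ W) (t, x) (0, 1) (0, 1)‖
        ≤ C * (‖W (t, x)‖ + ‖fderiv ℝ W (t, x) (1, 0)‖ + ‖fderiv ℝ W (t, x) (0, 1)‖))
    (h0 : ∀ x, |x - x₀| ≤ R → W (0, x) = 0)
    (h0' : ∀ x, |x - x₀| ≤ R → fderivWithin ℝ W (Icc 0 T ×ˢ univ) (0, x) = 0) :
    ∀ t ∈ Icc 0 T, ∀ x, |x - x₀| ≤ R - t → W (t, x) = 0 := by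
  set S : Set (ℝ × ℝ) := Icc 0 T ×ˢ univ with hS
  have hSu : UniqueDiffOn ℝ S := (uniqueDiffOn_Icc hT).prod uniqueDiffOn_univ
  set D := fderivWithin ℝ W S with hD
  have hDc : ContinuousOn D S := hW.continuousOn_fderivWithin hSu (by norm_num)
  have hWc : ContinuousOn W S := hW.continuousOn
  have hnhds : ∀ t ∈ Ioo 0 T, ∀ x, S ∈ 𝓝 (t, x) := fun t ht x =>
    prod_mem_nhds (Icc_mem_nhds ht.1 ht.2) univ_mem
  have hDint : ∀ t ∈ Ioo 0 T, ∀ x, D =ᶠ[𝓝 (t, x)] fderiv ℝ W := fun t ht x => by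
    filter_upwards [eventually_mem_nhds_iff.2 (hnhds t ht x)] with p hp
    exact fderivWithin_of_mem_nhds hp
  have hWd : ∀ t ∈ Ioo 0 T, ∀ x, HasFDerivAt W (D (t, x)) (t, x) := fun t ht x => by
    rw [(hDint t ht x).self_of_nhds]
    exact ((hW.contDiffAt (hnhds t ht x)).differentiableAt (by norm_num)).hasFDerivAt
  have hDd : ∀ t ∈ Ioo 0 T, ∀ x, HasFDerivAt D (fderiv ℝ (fderiv ℝ W) (t, x)) (t, x) :=
    fun t ht x => by
      refine HasFDerivAt.congr_of_eventuallyEq ?_ (hDint t ht x)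
      exact (((hW.contDiffAt (hnhds t ht x)).fderiv_right (m := 1)
        (by norm_num)).differentiableAt (by norm_num)).hasFDerivAt
  have hsym : ∀ t ∈ Ioo 0 T, ∀ x, IsSymmSndFDerivAt ℝ W (t, x) := fun t ht x =>
    (hW.contDiffAt (hnhds t ht x)).isSymmSndFDerivAt (by simp)
  set N : ℝ × ℝ → ℝ := fun p => ‖W p‖ + ‖D p (1, 1)‖ + ‖D p (1, -1)‖ with hN
  have hNc : ContinuousOn N S :=
    (hWc.norm.add (hDc.clm_apply continuousOn_const).norm).add
      (hDc.clm_apply continuousOn_const).norm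
  set l : ℝ := 6 * (C + 1) with hl
  have hlpos : 0 < l := by positivity
  set Q : Set (ℝ × ℝ) := {p | 0 ≤ p.1 ∧ p.1 ≤ T ∧ |p.2 - x₀| ≤ R - p.1} with hQ
  have hQS : Q ⊆ S := fun p hp => ⟨⟨hp.1, hp.2.1⟩, mem_univ _⟩
  have hQc : IsCompact Q := by
    refine (isCompact_Icc.prod isCompact_Icc :
      IsCompact (Icc (0:ℝ) T ×ˢ Icc (x₀ - R) (x₀ + R))).of_isClosed_subset ?_ ?_
    · simp only [hQ, ofPred_and]
      exact (isClosed_le continuous_const continuous_fst).inter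
        ((isClosed_le continuous_fst continuous_const).inter
          (isClosed_le (by fun_prop) (by fun_prop)))
    · rintro ⟨t, x⟩ ⟨h1, h2, h3⟩
      have := abs_le.1 h3
      exact ⟨⟨h1, h2⟩, by simp at this ⊢; constructor <;> linarith⟩
  suffices hmax : ∀ p ∈ Q, N p = 0 by
    intro t ht x hx
    have := hmax (t, x) ⟨ht.1, ht.2, hx⟩
    have h1 := norm_nonneg (D (t, x) (1, 1))
    have h2 := norm_nonneg (D (t, x) (1, -1))
    have h3 := norm_nonneg (W (t, x))
    exact norm_le_zero_iff.1 (by simp only [hN] at this; linarith)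
  rcases Q.eq_empty_or_nonempty with hQe | hQne
  · intro p hp; rw [hQe] at hp; exact hp.elim
  obtain ⟨⟨s, y⟩, hp, hpmax⟩ := hQc.exists_isMaxOn hQne
    (f := fun p => Real.exp (-(l * p.1)) * N p)
    ((by fun_prop : Continuous fun p : ℝ × ℝ => Real.exp (-(l * p.1))).continuousOn.mul
      (hNc.mono hQS))
  set M := Real.exp (-(l * s)) * N (s, y) with hM
  have hNnn : ∀ p, 0 ≤ N p := fun p => by positivity
  have hM0 : 0 ≤ M := mul_nonneg (Real.exp_pos _).le (hNnn _)
  have hNle : ∀ p ∈ Q, N p ≤ M * Real.exp (l * p.1) := fun p hpQ => by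
    have h1 : Real.exp (-(l * p.1)) * N p ≤ M := hpmax hpQ
    rw [Real.exp_neg, inv_mul_le_iff₀ (Real.exp_pos _)] at h1
    linarith
  obtain ⟨hs0, hsT, hyR⟩ := hp
  simp only at hs0 hsT hyR
  -- along a characteristic through `(s, y)`, which stays in the cone
  have key : ∀ σ : ℝ, |σ| = 1 → ∀ F : ℝ × ℝ → E, ContinuousOn F S →
      (∀ t ∈ Ioo 0 T, ∀ x, |x - x₀| ≤ R - t → ∃ G : ℝ × ℝ →L[ℝ] E, HasFDerivAt F G (t, x) ∧
        ‖G (1, -σ)‖ ≤ (C + 1) * N (t, x)) →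
      (∀ x, |x - x₀| ≤ R → F (0, x) = 0) →
      ‖F (s, y)‖ ≤ (C + 1) * M / l * Real.exp (l * s) := by
    intro σ hσ F hF hFd hF0
    have hin : ∀ r ∈ Icc 0 s, |y + σ * (s - r) - x₀| ≤ R - r := fun r hr => by
      calc |y + σ * (s - r) - x₀| = |(y - x₀) + σ * (s - r)| := by ring_nf
        _ ≤ |y - x₀| + |σ * (s - r)| := abs_add_le _ _
        _ = |y - x₀| + (s - r) := by
          rw [abs_mul, hσ, one_mul, abs_of_nonneg (sub_nonneg.2 hr.2)]
        _ ≤ R - r := by linarith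
    have hγ : ∀ r, HasDerivAt (fun r => ((r, y + σ * (s - r)) : ℝ × ℝ)) (1, -σ) r := fun r =>
      (hasDerivAt_id r).prodMk
        (((((hasDerivAt_id r).const_sub s).const_mul σ).const_add y).congr_deriv (by ring))
    choose! G hG using fun r (hr : r ∈ Ioo 0 s) => hFd r ⟨hr.1, hr.2.trans_le hsT⟩ _
      (hin r ⟨hr.1.le, hr.2.le⟩)
    have := norm_le_of_norm_deriv_le_exp (h := fun r => F (r, y + σ * (s - r)))
      (h' := fun r => G r (1, -σ)) (K := (C + 1) * M) (l := l) hs0 hlpos (by positivity)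
      (hF.comp (by fun_prop) fun r hr => ⟨⟨hr.1, hr.2.trans hsT⟩, mem_univ _⟩)
      (fun r hr => (hG r hr).1.comp_hasDerivAt r (hγ r))
      (fun r hr => (hG r hr).2.trans ?_)
      (hF0 _ (by simpa using hin 0 ⟨le_rfl, hs0⟩))
    · simpa using this
    · rw [mul_assoc]
      exact mul_le_mul_of_nonneg_left (hNle _ ⟨hr.1.le, hr.2.le.trans hsT,
        hin r ⟨hr.1.le, hr.2.le⟩⟩) (by positivity)
  have hvec : ∀ (L : ℝ × ℝ →L[ℝ] E), L (1, 1) = L (1, 0) + L (0, 1) ∧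
      L (1, -1) = L (1, 0) - L (0, 1) := fun L => by
    rw [← map_add, ← map_sub]; simp
  have hC1 : 1 ≤ C + 1 := by linarith
  have hbox : ∀ t ∈ Ioo 0 T, ∀ x, |x - x₀| ≤ R - t →
      ‖fderiv ℝ (fderiv ℝ W) (t, x) (1, 0) (1, 0) - fderiv ℝ (fderiv ℝ W) (t, x) (0, 1) (0, 1)‖
        ≤ (C + 1) * N (t, x) := fun t ht x hx => by
    refine (hineq t ht x hx).trans ?_
    rw [← (hDint t ht x).self_of_nhds]
    obtain ⟨e1, e2⟩ := hvec (D (t, x))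
    have e3 : D (t, x) (1, 0) = (2⁻¹ : ℝ) • (D (t, x) (1, 1) + D (t, x) (1, -1)) := by
      rw [e1, e2]; module
    have e4 : D (t, x) (0, 1) = (2⁻¹ : ℝ) • (D (t, x) (1, 1) - D (t, x) (1, -1)) := by
      rw [e1, e2]; module
    have n3 : ‖D (t, x) (1, 0)‖ ≤ 2⁻¹ * (‖D (t, x) (1, 1)‖ + ‖D (t, x) (1, -1)‖) := by
      rw [e3, norm_smul]; norm_num; exact norm_add_le _ _
    have n4 : ‖D (t, x) (0, 1)‖ ≤ 2⁻¹ * (‖D (t, x) (1, 1)‖ + ‖D (t, x) (1, -1)‖) := by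
      rw [e4, norm_smul]; norm_num; exact norm_sub_le _ _
    have n5 : ‖W (t, x)‖ + ‖D (t, x) (1, 0)‖ + ‖D (t, x) (0, 1)‖ ≤ N (t, x) := by
      simp only [hN]; linarith
    exact mul_le_mul (by linarith) n5 (by positivity) (by positivity)
  have happly : ∀ v : ℝ × ℝ, ∀ t ∈ Ioo 0 T, ∀ x, HasFDerivAt (fun p => D p v)
      ((ContinuousLinearMap.apply ℝ E v).comp (fderiv ℝ (fderiv ℝ W) (t, x))) (t, x) :=
    fun v t ht x => (ContinuousLinearMap.apply ℝ E v).hasFDerivAt.comp (t, x) (hDd t ht x)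
  have hA := key 1 (by simp) (fun p => D p (1, 1)) (hDc.clm_apply continuousOn_const)
    (fun t ht x hx => ⟨_, happly (1, 1) t ht x, by
      have hs := hsym t ht x (1, 0) (0, 1)
      refine le_trans (le_of_eq ?_) (hbox t ht x hx)
      simp only [ContinuousLinearMap.comp_apply, ContinuousLinearMap.apply_apply]
      rw [(hvec (fderiv ℝ (fderiv ℝ W) (t, x) (1, -1))).1]
      have e := congrArg (fun L : ℝ × ℝ →L[ℝ] E => L (1, 0) + L (0, 1))
        (show fderiv ℝ (fderiv ℝ W) (t, x) (1, -1) = fderiv ℝ (fderiv ℝ W) (t, x) (1, 0)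
          - fderiv ℝ (fderiv ℝ W) (t, x) (0, 1) by rw [← map_sub]; simp)
      simp only [sub_apply] at e
      rw [e, hs]; congr 1; abel⟩)
    (fun x hx => by simp [h0' x hx])
  have hB := key (-1) (by simp) (fun p => D p (1, -1)) (hDc.clm_apply continuousOn_const)
    (fun t ht x hx => ⟨_, happly (1, -1) t ht x, by
      have hs := hsym t ht x (1, 0) (0, 1)
      refine le_trans (le_of_eq ?_) (hbox t ht x hx)
      simp only [ContinuousLinearMap.comp_apply, ContinuousLinearMap.apply_apply, neg_neg]
      rw [(hvec (fderiv ℝ (fderiv ℝ W) (t, x) (1, 1))).2]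
      have e := congrArg (fun L : ℝ × ℝ →L[ℝ] E => L (1, 0) - L (0, 1))
        (show fderiv ℝ (fderiv ℝ W) (t, x) (1, 1) = fderiv ℝ (fderiv ℝ W) (t, x) (1, 0)
          + fderiv ℝ (fderiv ℝ W) (t, x) (0, 1) by rw [← map_add]; simp)
      simp only [add_apply] at e
      rw [e, hs]; congr 1; abel⟩)
    (fun x hx => by simp [h0' x hx])
  have hF := key 1 (by simp) W hWc
    (fun t ht x hx => ⟨_, hWd t ht x, by
      have : ‖D (t, x) (1, -1)‖ ≤ N (t, x) := by
        simp only [hN]; linarith [norm_nonneg (W (t, x)), norm_nonneg (D (t, x) (1, 1))]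
      exact this.trans (le_mul_of_one_le_left (hNnn _) hC1)⟩) h0
  have hsum : N (s, y) ≤ 3 * ((C + 1) * M / l * Real.exp (l * s)) := by
    simp only [hN]; linarith
  have h3 : 3 * ((C + 1) * M / l * Real.exp (l * s)) = M / 2 * Real.exp (l * s) := by
    rw [hl]; field_simp; ring
  have hMle : M ≤ M / 2 := by
    have h4 : Real.exp (-(l * s)) * Real.exp (l * s) = 1 := by rw [← Real.exp_add]; simp
    calc M = Real.exp (-(l * s)) * N (s, y) := hM
      _ ≤ Real.exp (-(l * s)) * (M / 2 * Real.exp (l * s)) :=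
        mul_le_mul_of_nonneg_left (h3 ▸ hsum) (Real.exp_pos _).le
      _ = M / 2 := by linear_combination M / 2 * h4
  have hMz : M = 0 := by linarith
  intro p hpQ
  have := hNle p hpQ
  rw [hMz, zero_mul] at this
  exact le_antisymm this (hNnn p)

/-- A classical wave map on `[0, T] × ℝ` with zero initial velocity, the equation being required
at interior times only. Both halves of a solution on a general time interval are of this kind, the
negative one after time reversal. -/
structure IsForwardWaveMap {m : ℕ} (T : ℝ) (f : ℝ → Amb m) (φ : ℝ → ℝ → Amb m) : Prop where
  contDiffOn : ContDiffOn ℝ 2 (fun p : ℝ × ℝ => φ p.1 p.2) (Icc 0 T ×ˢ univ)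
  equation : ∀ t ∈ Ioo 0 T, ∀ x : ℝ,
    (-iteratedDeriv 2 (fun r => φ r x) t + iteratedDeriv 2 (φ t) x) +
      (-‖deriv (fun r => φ r x) t‖ ^ 2 + ‖deriv (φ t) x‖ ^ 2) • φ t x = 0
  position : φ 0 = f
  velocity : ∀ x : ℝ, HasDerivWithinAt (fun r => φ r x) 0 (Icc 0 T) 0

theorem IsWaveMapOn.hasDerivWithinAt_zero {m : ℕ} {I : Set ℝ} {f : ℝ → Amb m}
    {φ : ℝ → ℝ → Amb m} (h : IsWaveMapOn I f φ) (h0 : (0 : ℝ) ∈ I) (x : ℝ) :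
    HasDerivWithinAt (fun r => φ r x) 0 I 0 := by
  have hd : DifferentiableWithinAt ℝ (fun r => φ r x) I 0 :=
    DifferentiableWithinAt.comp (t := I ×ˢ univ) (g := fun p : ℝ × ℝ => φ p.1 p.2) 0
      ((h.contDiffOn.differentiableOn (by norm_num)) (0, x) ⟨h0, mem_univ _⟩)
      (by fun_prop : DifferentiableWithinAt ℝ (fun r : ℝ => (r, x)) I 0)
      fun r hr => ⟨hr, mem_univ _⟩
  have := hd.hasDerivWithinAt
  rwa [h.velocity x] at this

theorem iteratedDerivWithin_two_of_mem_nhds {E : Type*} [NormedAddCommGroup E] [NormedSpace ℝ E]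
    {g : ℝ → E} {I : Set ℝ} {t : ℝ} (hI : I ∈ 𝓝 t) :
    iteratedDerivWithin 2 g I t = iteratedDeriv 2 g t := by
  rw [iteratedDerivWithin_succ, iteratedDeriv_succ, derivWithin_of_mem_nhds hI]
  apply Filter.EventuallyEq.deriv_eq
  filter_upwards [eventually_mem_nhds_iff.2 hI] with s hs
  rw [iteratedDeriv_one, iteratedDerivWithin_one, derivWithin_of_mem_nhds hs]

theorem IsWaveMapOn.isForwardWaveMap {m : ℕ} {I : Set ℝ} {f : ℝ → Amb m} {φ : ℝ → ℝ → Amb m}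
    (h : IsWaveMapOn I f φ) {T : ℝ} (hT : 0 < T) (hI : Icc 0 T ⊆ I) : IsForwardWaveMap T f φ where
  contDiffOn := h.contDiffOn.mono (prod_mono hI subset_rfl)
  equation := fun t ht x => by
    have hn : I ∈ 𝓝 t := mem_of_superset (Icc_mem_nhds ht.1 ht.2) hI
    have := h.equation t (mem_of_mem_nhds hn) x
    rwa [derivWithin_of_mem_nhds hn, iteratedDerivWithin_two_of_mem_nhds hn] at this
  position := h.position
  velocity := fun x => (h.hasDerivWithinAt_zero (hI ⟨le_rfl, hT.le⟩) x).mono hI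

theorem IsWaveMapOn.isForwardWaveMap_neg {m : ℕ} {I : Set ℝ} {f : ℝ → Amb m}
    {φ : ℝ → ℝ → Amb m} (h : IsWaveMapOn I f φ) {T : ℝ} (hT : 0 < T) (hI : Icc (-T) 0 ⊆ I) :
    IsForwardWaveMap T f (fun t => φ (-t)) where
  contDiffOn := by
    have hc : ContDiff ℝ 2 (fun p : ℝ × ℝ => ((-p.1, p.2) : ℝ × ℝ)) := by fun_prop
    exact h.contDiffOn.comp hc.contDiffOn
      fun p hp => ⟨hI ⟨by linarith [hp.1.2], by linarith [hp.1.1]⟩, mem_univ _⟩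
  equation := fun t ht x => by
    have hn : I ∈ 𝓝 (-t) :=
      mem_of_superset (Icc_mem_nhds (by linarith [ht.2]) (by linarith [ht.1])) hI
    have := h.equation (-t) (mem_of_mem_nhds hn) x
    rw [derivWithin_of_mem_nhds hn, iteratedDerivWithin_two_of_mem_nhds hn] at this
    rw [iteratedDeriv_comp_neg 2 (fun r => φ r x) t, deriv_comp_neg (fun r => φ r x) t]
    simpa using this
  position := by simpa using h.position
  velocity := fun x => by
    have h1 := (h.hasDerivWithinAt_zero (hI ⟨by linarith, le_rfl⟩) x).mono hI
    have h2 : HasDerivWithinAt (fun r : ℝ => -r) (-1) (Icc 0 T) 0 :=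
      (hasDerivAt_neg 0).hasDerivWithinAt
    have := HasDerivWithinAt.scomp_of_eq (h := fun r : ℝ => -r) (0 : ℝ) h1 h2
      (fun r hr => ⟨by linarith [hr.2], by linarith [hr.1]⟩) (by simp)
    simpa [Function.comp_def] using this

/-- First and second derivatives of a `C²` function along a line. -/
theorem iteratedDeriv_two_comp_line {F E : Type*} [NormedAddCommGroup F] [NormedSpace ℝ F]
    [NormedAddCommGroup E] [NormedSpace ℝ E] {U : F → E} {γ : ℝ → F} {v : F} {r : ℝ}
    (hU : ContDiffAt ℝ 2 U (γ r)) (hγ : ∀ r, HasDerivAt γ v r) :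
    deriv (fun r => U (γ r)) r = fderiv ℝ U (γ r) v ∧
      iteratedDeriv 2 (fun r => U (γ r)) r = fderiv ℝ (fderiv ℝ U) (γ r) v v := by
  have h1 : ∀ᶠ s in 𝓝 r, HasDerivAt (fun r => U (γ r)) (fderiv ℝ U (γ s) v) s := by
    have := (hγ r).continuousAt.eventually (hU.eventually (by simp))
    filter_upwards [this] with s hs
    exact (hs.differentiableAt (by norm_num)).hasFDerivAt.comp_hasDerivAt s (hγ s)
  refine ⟨h1.self_of_nhds.deriv, ?_⟩
  rw [iteratedDeriv_succ, iteratedDeriv_one]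
  have h2 : deriv (fun r => U (γ r)) =ᶠ[𝓝 r] fun s => fderiv ℝ U (γ s) v :=
    h1.mono fun s hs => hs.deriv
  rw [h2.deriv_eq]
  have h3 : HasDerivAt (fun s => fderiv ℝ U (γ s)) (fderiv ℝ (fderiv ℝ U) (γ r) v) r :=
    (((hU.fderiv_right (m := 1) (by norm_num)).differentiableAt
      (by norm_num)).hasFDerivAt).comp_hasDerivAt r (hγ r)
  simpa using (h3.clm_apply (hasDerivAt_const r v)).deriv

/-- The nonlinearity of the wave map equation is Lipschitz on bounded sets. -/
theorem norm_wave_nonlinearity_sub_le {E : Type*} [NormedAddCommGroup E] [NormedSpace ℝ E]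
    {A A' G G' u v p q p' q' : E} {B : ℝ} (hu : ‖u‖ ≤ B) (hp : ‖p‖ ≤ B) (hq : ‖q‖ ≤ B)
    (hp' : ‖p'‖ ≤ B) (hq' : ‖q'‖ ≤ B)
    (hA : (-A + A') + (-‖p‖ ^ 2 + ‖q‖ ^ 2) • u = 0)
    (hG : (-G + G') + (-‖p'‖ ^ 2 + ‖q'‖ ^ 2) • v = 0) :
    ‖A - G - (A' - G')‖ ≤ 2 * B ^ 2 * (‖u - v‖ + ‖p - p'‖ + ‖q - q'‖) := by
  have hB : 0 ≤ B := (norm_nonneg u).trans hu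
  have hid : A - G - (A' - G') = ((‖q‖ ^ 2 - ‖q'‖ ^ 2) - (‖p‖ ^ 2 - ‖p'‖ ^ 2)) • u
      + (‖q'‖ ^ 2 - ‖p'‖ ^ 2) • (u - v) := by
    have h : A - A' = (-‖p‖ ^ 2 + ‖q‖ ^ 2) • u := by
      rw [← sub_eq_zero, ← neg_eq_zero, ← hA]; module
    have h' : G - G' = (-‖p'‖ ^ 2 + ‖q'‖ ^ 2) • v := by
      rw [← sub_eq_zero, ← neg_eq_zero, ← hG]; module
    rw [show A - G - (A' - G') = (A - A') - (G - G') by abel, h, h']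
    module
  have hdiff : ∀ a b : E, ‖a‖ ≤ B → ‖b‖ ≤ B →
      |‖a‖ ^ 2 - ‖b‖ ^ 2| ≤ 2 * B * ‖a - b‖ := fun a b ha hb => by
    rw [sq_sub_sq, abs_mul]
    have h1 : |‖a‖ + ‖b‖| ≤ 2 * B := by
      rw [abs_of_nonneg (by positivity)]; linarith
    exact mul_le_mul h1 (abs_norm_sub_norm_le a b) (abs_nonneg _) (by positivity)
  have e1 := hdiff p p' hp hp'
  have e2 := hdiff q q' hq hq'
  have e3 : |‖q'‖ ^ 2 - ‖p'‖ ^ 2| ≤ 2 * B ^ 2 := by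
    have h1 : ‖q'‖ ^ 2 ≤ B ^ 2 := pow_le_pow_left₀ (norm_nonneg _) hq' 2
    have h2 : ‖p'‖ ^ 2 ≤ B ^ 2 := pow_le_pow_left₀ (norm_nonneg _) hp' 2
    rw [abs_le]; constructor <;> linarith [sq_nonneg ‖q'‖, sq_nonneg ‖p'‖]
  rw [hid]
  calc _ ≤ |(‖q‖ ^ 2 - ‖q'‖ ^ 2) - (‖p‖ ^ 2 - ‖p'‖ ^ 2)| * ‖u‖
        + |‖q'‖ ^ 2 - ‖p'‖ ^ 2| * ‖u - v‖ := by
        refine (norm_add_le _ _).trans (le_of_eq ?_)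
        rw [norm_smul, norm_smul, Real.norm_eq_abs, Real.norm_eq_abs]
    _ ≤ (2 * B * ‖q - q'‖ + 2 * B * ‖p - p'‖) * B + 2 * B ^ 2 * ‖u - v‖ := by
        gcongr
        exact (abs_sub _ _).trans (add_le_add e2 e1)
    _ = _ := by ring

/-- Two classical wave maps whose data agree near the base of a truncated backward cone agree in
the cone. -/
theorem IsForwardWaveMap.eq_of_eventuallyEq {m : ℕ} {T R x₀ : ℝ} {f g : ℝ → Amb m}
    {φ ψ : ℝ → ℝ → Amb m} (hT : 0 < T) (hφ : IsForwardWaveMap T f φ) (hψ : IsForwardWaveMap T g ψ)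
    (hfg : ∀ x, |x - x₀| ≤ R → f =ᶠ[𝓝 x] g) :
    ∀ t ∈ Icc 0 T, ∀ x, |x - x₀| ≤ R - t → φ t x = ψ t x := by
  set S : Set (ℝ × ℝ) := Icc 0 T ×ˢ univ with hS
  set U : ℝ × ℝ → Amb m := fun p => φ p.1 p.2 with hU
  set V : ℝ × ℝ → Amb m := fun p => ψ p.1 p.2 with hV
  have hSu : UniqueDiffOn ℝ S := (uniqueDiffOn_Icc hT).prod uniqueDiffOn_univ
  have hnhds : ∀ t ∈ Ioo 0 T, ∀ x, S ∈ 𝓝 (t, x) := fun t ht x =>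
    prod_mem_nhds (Icc_mem_nhds ht.1 ht.2) univ_mem
  have hγt : ∀ x r : ℝ, HasDerivAt (fun r : ℝ => (r, x)) ((1, 0) : ℝ × ℝ) r := fun x r =>
    (hasDerivAt_id r).prodMk (hasDerivAt_const r x)
  have hγx : ∀ t r : ℝ, HasDerivAt (fun r : ℝ => (t, r)) ((0, 1) : ℝ × ℝ) r := fun t r =>
    (hasDerivAt_const r t).prodMk (hasDerivAt_id r)
  -- a common bound for both maps and their first derivatives over the compact cone
  obtain ⟨B, hB⟩ : ∃ B, ∀ t ∈ Icc 0 T, ∀ x, |x - x₀| ≤ R - t →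
      ‖U (t, x)‖ ≤ B ∧ ‖fderivWithin ℝ U S (t, x)‖ ≤ B ∧ ‖fderivWithin ℝ V S (t, x)‖ ≤ B := by
    have hK : IsCompact (Icc (0 : ℝ) T ×ˢ Icc (x₀ - R) (x₀ + R)) := isCompact_Icc.prod isCompact_Icc
    have hKS : (Icc (0 : ℝ) T ×ˢ Icc (x₀ - R) (x₀ + R)) ⊆ S := prod_mono subset_rfl (subset_univ _)
    obtain ⟨B₁, h₁⟩ := hK.exists_bound_of_continuousOn (hφ.contDiffOn.continuousOn.mono hKS)
    obtain ⟨B₂, h₂⟩ := hK.exists_bound_of_continuousOn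
      ((hφ.contDiffOn.continuousOn_fderivWithin hSu (by norm_num)).mono hKS)
    obtain ⟨B₃, h₃⟩ := hK.exists_bound_of_continuousOn
      ((hψ.contDiffOn.continuousOn_fderivWithin hSu (by norm_num)).mono hKS)
    refine ⟨max B₁ (max B₂ B₃), fun t ht x hx => ?_⟩
    have hm : (t, x) ∈ Icc (0 : ℝ) T ×ˢ Icc (x₀ - R) (x₀ + R) := by
      have := abs_le.1 hx
      exact ⟨ht, by linarith [ht.1], by linarith [ht.1]⟩
    exact ⟨(h₁ _ hm).trans (le_max_left _ _),
      (h₂ _ hm).trans ((le_max_left _ _).trans (le_max_right _ _)),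
      (h₃ _ hm).trans ((le_max_right _ _).trans (le_max_right _ _))⟩
  have hB0 : 0 ≤ |B| := abs_nonneg B
  have hmain := eq_zero_of_wave_inequality (W := U - V) (T := T) (R := R) (x₀ := x₀)
    (C := 2 * |B| ^ 2) hT (by positivity) (hφ.contDiffOn.sub hψ.contDiffOn) ?_ ?_ ?_
  · intro t ht x hx
    exact sub_eq_zero.1 (hmain t ht x hx)
  · intro t ht x hx
    have hUc : ContDiffAt ℝ 2 U (t, x) := hφ.contDiffOn.contDiffAt (hnhds t ht x)
    have hVc : ContDiffAt ℝ 2 V (t, x) := hψ.contDiffOn.contDiffAt (hnhds t ht x)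
    have hWc : ContDiffAt ℝ 2 (U - V) (t, x) := hUc.sub hVc
    obtain ⟨u1, u2⟩ := iteratedDeriv_two_comp_line (γ := fun r => (r, x)) hUc (hγt x)
    obtain ⟨u3, u4⟩ := iteratedDeriv_two_comp_line (γ := fun r => (t, r)) hUc (hγx t)
    obtain ⟨v1, v2⟩ := iteratedDeriv_two_comp_line (γ := fun r => (r, x)) hVc (hγt x)
    obtain ⟨v3, v4⟩ := iteratedDeriv_two_comp_line (γ := fun r => (t, r)) hVc (hγx t)
    have hUe := hφ.equation t ht x
    have hVe := hψ.equation t ht x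
    simp only [hU, hV] at u1 u2 u3 u4 v1 v2 v3 v4
    rw [u1, u2, u3, u4] at hUe
    rw [v1, v2, v3, v4] at hVe
    have hd1 : fderiv ℝ (U - V) (t, x) = fderiv ℝ U (t, x) - fderiv ℝ V (t, x) :=
      fderiv_sub (hUc.differentiableAt (by norm_num)) (hVc.differentiableAt (by norm_num))
    have hd1' : fderiv ℝ (U - V) =ᶠ[𝓝 (t, x)] fderiv ℝ U - fderiv ℝ V := by
      filter_upwards [hUc.eventually (by simp), hVc.eventually (by simp)] with p hp hq
      exact fderiv_sub (hp.differentiableAt (by norm_num)) (hq.differentiableAt (by norm_num))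
    have hd2 : fderiv ℝ (fderiv ℝ (U - V)) (t, x)
        = fderiv ℝ (fderiv ℝ U) (t, x) - fderiv ℝ (fderiv ℝ V) (t, x) := by
      rw [hd1'.fderiv_eq]
      exact fderiv_sub
        ((hUc.fderiv_right (m := 1) (by norm_num)).differentiableAt (by norm_num))
        ((hVc.fderiv_right (m := 1) (by norm_num)).differentiableAt (by norm_num))
    obtain ⟨b1, b2, b3⟩ := hB t ⟨ht.1.le, ht.2.le⟩ x hx
    rw [fderivWithin_of_mem_nhds (hnhds t ht x)] at b2 b3
    rw [hd1, hd2]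
    simp only [sub_apply, Pi.sub_apply]
    have hn1 : ‖((1, 0) : ℝ × ℝ)‖ = 1 := by simp
    have hn2 : ‖((0, 1) : ℝ × ℝ)‖ = 1 := by simp
    have bound : ∀ (L : ℝ × ℝ →L[ℝ] Amb m) (w : ℝ × ℝ), ‖L‖ ≤ B → ‖w‖ = 1 → ‖L w‖ ≤ |B| :=
      fun L w hL hw => (L.le_opNorm w).trans (by rw [hw, mul_one]; exact hL.trans (le_abs_self B))
    have c1 := bound _ _ b2 hn1
    have c2 := bound _ _ b2 hn2
    have c3 := bound _ _ b3 hn1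
    have c4 := bound _ _ b3 hn2
    have c5 : ‖U (t, x)‖ ≤ |B| := b1.trans (le_abs_self B)
    exact norm_wave_nonlinearity_sub_le c5 c1 c2 c3 c4 hUe hVe
  · intro x hx
    have : f x = g x := (hfg x hx).self_of_nhds
    simp [hU, hV, hφ.position, hψ.position, this]
  · intro x hx
    have hmem : ((0 : ℝ), x) ∈ S := ⟨⟨le_rfl, hT.le⟩, mem_univ _⟩
    have hWd : HasFDerivWithinAt (U - V) (fderivWithin ℝ (U - V) S (0, x)) S (0, x) :=
      (((hφ.contDiffOn.sub hψ.contDiffOn).differentiableOn (by norm_num))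
        (0, x) hmem).hasFDerivWithinAt
    have ht : fderivWithin ℝ (U - V) S (0, x) (1, 0) = 0 := by
      have h1 : HasDerivWithinAt (fun r => (U - V) (r, x)) (fderivWithin ℝ (U - V) S (0, x) (1, 0))
          (Icc 0 T) 0 :=
        hWd.comp_hasDerivWithinAt (f := fun r : ℝ => (r, x)) 0 (hγt x 0).hasDerivWithinAt
          fun r hr => ⟨hr, mem_univ _⟩
      have h2 : HasDerivWithinAt (fun r => (U - V) (r, x)) (0 - 0) (Icc 0 T) 0 :=
        (hφ.velocity x).sub (hψ.velocity x)
      simpa using (uniqueDiffOn_Icc hT 0 ⟨le_rfl, hT.le⟩).eq_deriv _ h1 h2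
    have hx' : fderivWithin ℝ (U - V) S (0, x) (0, 1) = 0 := by
      have h1 : HasDerivWithinAt (fun y => (U - V) (0, y)) (fderivWithin ℝ (U - V) S (0, x) (0, 1))
          univ x :=
        hWd.comp_hasDerivWithinAt (f := fun y : ℝ => (0, y)) x (hγx 0 x).hasDerivWithinAt
          fun r _ => ⟨⟨le_rfl, hT.le⟩, mem_univ _⟩
      rw [hasDerivWithinAt_univ] at h1
      have h2 : (fun y => (U - V) (0, y)) =ᶠ[𝓝 x] fun _ => 0 := by
        filter_upwards [hfg x hx] with y hy
        simp [hU, hV, hφ.position, hψ.position, hy]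
      exact h1.unique ((hasDerivAt_const x (0 : Amb m)).congr_of_eventuallyEq h2)
    ext1
    · ext1; simpa using ht
    · ext1; simpa using hx'

/-! ### A jump forces the homogeneous Sobolev norm to be large -/

theorem exists_schwartz_of_hasCompactSupport {f : ℝ → ℂ} (hc : HasCompactSupport f)
    (hf : ContDiff ℝ ∞ f) : ∃ ψ : 𝓢(ℝ, ℂ), ∀ x, ψ x = f x :=
  ⟨hc.toSchwartzMap hf, fun _ => rfl⟩

/-- Multiplication by `-2πiξ` becomes differentiation after the Fourier transform. -/
theorem hasDerivAt_fourier_schwartz {Ψ ψ : 𝓢(ℝ, ℂ)}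
    (h : ∀ x : ℝ, ψ x = (-2 * Real.pi * Complex.I * x) • Ψ x) (w : ℝ) :
    HasDerivAt (𝓕 Ψ : 𝓢(ℝ, ℂ)) ((𝓕 ψ : 𝓢(ℝ, ℂ)) w) w := by
  rw [SchwartzMap.fourier_coe, SchwartzMap.fourier_coe, show (ψ : ℝ → ℂ) = _ from funext h]
  refine Real.hasDerivAt_fourier Ψ.integrable ?_ w
  refine ((Ψ.integrable_pow_mul volume 1).congr' ?_ ?_)
  · exact (continuous_id.smul Ψ.continuous).aestronglyMeasurable
  · exact Eventually.of_forall fun x => by simp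

/-- A Schwartz function with support in the frequency band `(1, 2)` whose Fourier transform has
opposite nonzero integrals over the two half lines: it is `ξ ↦ -2πi ξ χ(ξ)` for a bump function
`χ`, and its Fourier transform is the derivative of that of `χ`. -/
theorem exists_band_limited_profile :
    ∃ (ψ : 𝓢(ℝ, ℂ)) (A : ℂ), A ≠ 0 ∧ Function.support ψ ⊆ Ioo 1 2 ∧
      ∫ y in Ioi (0 : ℝ), (𝓕 ψ) y = A ∧ ∫ y in Iic (0 : ℝ), (𝓕 ψ) y = -A := by
  obtain ⟨χ, hχ⟩ : ∃ χ : ContDiffBump (3 / 2 : ℝ), Function.support χ = Ioo 1 2 := by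
    refine ⟨⟨1 / 4, 1 / 2, by norm_num, by norm_num⟩, ?_⟩
    rw [ContDiffBump.support_eq, Real.ball_eq_Ioo]; norm_num
  have hΨsm : ContDiff ℝ ∞ (fun x => (χ x : ℂ)) := Complex.ofRealCLM.contDiff.comp χ.contDiff
  have hΨc : HasCompactSupport (fun x => (χ x : ℂ)) :=
    χ.hasCompactSupport.comp_left (g := ((↑) : ℝ → ℂ)) (by simp)
  obtain ⟨Ψ, hΨ⟩ := exists_schwartz_of_hasCompactSupport hΨc hΨsm
  have hψsm : ContDiff ℝ ∞ fun x : ℝ => (-2 * Real.pi * Complex.I * x) • (χ x : ℂ) :=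
    (contDiff_const.mul Complex.ofRealCLM.contDiff).smul hΨsm
  have hψc : HasCompactSupport fun x : ℝ => (-2 * Real.pi * Complex.I * x) • (χ x : ℂ) :=
    hΨc.mono' fun x hx => subset_tsupport _ fun h => hx (by simp only [h, smul_zero])
  obtain ⟨ψ, hψ⟩ := exists_schwartz_of_hasCompactSupport hψc hψsm
  have hderiv := hasDerivAt_fourier_schwartz (Ψ := Ψ) (ψ := ψ) fun x => by rw [hψ, hΨ]
  have h0 : (𝓕 Ψ : 𝓢(ℝ, ℂ)) 0 ≠ 0 := by
    rw [SchwartzMap.fourier_coe, Real.fourier_eq]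
    simp only [inner_zero_right, neg_zero, AddChar.map_zero_eq_one, one_smul, hΨ]
    rw [integral_complex_ofReal]
    exact_mod_cast χ.integral_pos.ne'
  have hsupp : Function.support ψ ⊆ Ioo 1 2 := fun x hx => by
    rw [← hχ]
    intro h
    exact hx (by rw [hψ, h]; simp)
  generalize (𝓕 Ψ : 𝓢(ℝ, ℂ)) = G at hderiv h0
  have hint : Integrable (𝓕 ψ : 𝓢(ℝ, ℂ)) := (𝓕 ψ : 𝓢(ℝ, ℂ)).integrable
  have hzero : Tendsto G (cocompact ℝ) (𝓝 0) := zero_at_infty G.toZeroAtInfty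
  refine ⟨ψ, -G 0, neg_ne_zero.2 h0, hsupp, ?_, ?_⟩
  · rw [integral_Ioi_of_hasDerivAt_of_tendsto (a := 0) (f := G)
      G.continuous.continuousWithinAt (fun x _ => hderiv x) hint.integrableOn
      (hzero.mono_left atTop_le_cocompact), zero_sub]
  · rw [integral_Iic_of_hasDerivAt_of_tendsto (a := 0) (f := G)
      G.continuous.continuousWithinAt (fun x _ => hderiv x) hint.integrableOn
      (hzero.mono_left atBot_le_cocompact), sub_zero, neg_neg]

/-- Pairing a bounded function that takes the value `p` just left of `0` and `q` right of a
transition layer of width `b` with `η` gives `(q - p) ∫_{y > 0} η`, up to errors from the transition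
layer and from the tails `|y| > a`. -/
theorem norm_integral_mul_sub_step_le {η : ℝ → ℂ} {A : ℂ} {M₀ M p q a b : ℝ} {h : ℝ → ℝ}
    (hη : Integrable η) (hη1 : Integrable fun y => |y| * ‖η y‖)
    (hA : ∫ y in Ioi (0 : ℝ), η y = A) (hA' : ∫ y in Iic (0 : ℝ), η y = -A)
    (hM₀ : ∀ y, ‖η y‖ ≤ M₀) (ha : 0 < a) (hb : 0 ≤ b)
    (hh : AEStronglyMeasurable h) (hM : ∀ᵐ y, |h y| ≤ M) (hpM : |p| ≤ M) (hqM : |q| ≤ M)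
    (hp : ∀ y ∈ Icc (-a) 0, h y = p) (hq : ∀ y ∈ Icc b a, h y = q) :
    ‖(∫ y, (h y : ℂ) * η y) - (q - p) * A‖ ≤
      2 * M * (b * M₀ + (∫ y, |y| * ‖η y‖) / a) := by
  set st : ℝ → ℝ := fun y => if 0 < y then q else p with hst
  have hM0 : 0 ≤ M := (abs_nonneg p).trans hpM
  have hstM : ∀ y, |st y| ≤ M := fun y => by
    simp only [hst]; split_ifs <;> assumption
  have hstm : Measurable st := Measurable.ite measurableSet_Ioi measurable_const measurable_const
  have hint1 : Integrable fun y => (h y : ℂ) * η y := by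
    refine hη.bdd_mul (c := M) (Complex.continuous_ofReal.comp_aestronglyMeasurable hh) ?_
    filter_upwards [hM] with y hy; simpa using hy
  have hint2 : Integrable fun y => (st y : ℂ) * η y := by
    refine hη.bdd_mul (c := M)
      (Complex.continuous_ofReal.comp_aestronglyMeasurable hstm.aestronglyMeasurable) ?_
    exact Eventually.of_forall fun y => by simpa using hstM y
  have hstep : ∫ y, (st y : ℂ) * η y = (q - p) * A := by
    rw [← integral_add_compl measurableSet_Ioi hint2 (s := Ioi (0 : ℝ)), compl_Ioi,
      setIntegral_congr_fun measurableSet_Ioi (g := fun y => (q : ℂ) * η y)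
        (fun y hy => by simp [hst, show (0 : ℝ) < y from hy]),
      setIntegral_congr_fun measurableSet_Iic (g := fun y => (p : ℂ) * η y)
        (fun y hy => by simp [hst, not_lt.2 (show y ≤ (0 : ℝ) from hy)]),
      integral_const_mul, integral_const_mul, hA, hA']
    ring
  rw [← hstep, ← integral_sub hint1 hint2]
  have hbd : Integrable fun y =>
      2 * M * ((Ioo 0 b).indicator (fun _ => M₀) y + |y| * ‖η y‖ / a) := by
    refine Integrable.const_mul (Integrable.add ?_ (hη1.div_const a)) _
    exact (integrable_indicator_iff measurableSet_Ioo).2 (integrableOn_const (by simp))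
  refine (norm_integral_le_of_norm_le hbd ?_).trans (le_of_eq ?_)
  · filter_upwards [hM] with y hy
    rw [← sub_mul, norm_mul, ← Complex.ofReal_sub, Complex.norm_real, Real.norm_eq_abs]
    have hM₀' : 0 ≤ M₀ := (norm_nonneg _).trans (hM₀ 0)
    have hd : |h y - st y| ≤ 2 * M := (abs_sub _ _).trans (by linarith [hstM y])
    have hi : 0 ≤ (Ioo 0 b).indicator (fun _ => M₀) y := indicator_nonneg (fun _ _ => hM₀') y
    have hη0 := norm_nonneg (η y)
    by_cases hya : |y| ≤ a
    · have hya' := abs_le.1 hya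
      by_cases hy0 : y ≤ 0
      · have : h y - st y = 0 := by
          rw [hp y ⟨hya'.1, hy0⟩]; simp [hst, not_lt.2 hy0]
        rw [this, abs_zero, zero_mul]; positivity
      · push Not at hy0
        by_cases hyb : b ≤ y
        · have : h y - st y = 0 := by
            rw [hq y ⟨hyb, hya'.2⟩]; simp [hst, hy0]
          rw [this, abs_zero, zero_mul]; positivity
        · push Not at hyb
          rw [indicator_of_mem (show y ∈ Ioo 0 b from ⟨hy0, hyb⟩)]
          refine mul_le_mul hd ?_ hη0 (by positivity)
          have : 0 ≤ |y| * ‖η y‖ / a := by positivity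
          linarith [hM₀ y]
    · push Not at hya
      refine mul_le_mul hd ?_ hη0 (by positivity)
      have : ‖η y‖ ≤ |y| * ‖η y‖ / a := by
        rw [le_div_iff₀ ha]; nlinarith
      linarith
  · rw [integral_const_mul, integral_add, integral_indicator measurableSet_Ioo,
      integral_div]
    · simp [hb]
    · exact (integrable_indicator_iff measurableSet_Ioo).2 (integrableOn_const (by simp))
    · exact hη1.div_const a

/-- Rescaling and translating a test function. -/
theorem fourier_modulate_dilate (ψ : ℝ → ℂ) (x₁ : ℝ) {ρ : ℝ} (hρ : 0 < ρ) (x : ℝ) :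
    𝓕 (fun ξ : ℝ => Complex.exp (↑(2 * Real.pi * x₁ * ξ) * Complex.I) * ψ (ρ * ξ)) x
      = (ρ⁻¹ : ℝ) • 𝓕 ψ ((x - x₁) / ρ) := by
  rw [Real.fourier_eq', Real.fourier_eq']
  have := Measure.integral_comp_mul_left (fun v : ℝ =>
    Complex.exp (↑(-2 * Real.pi * inner ℝ v ((x - x₁) / ρ)) * Complex.I) • ψ v) ρ
  rw [abs_of_pos (inv_pos.2 hρ)] at this
  rw [← this]
  congr 1
  funext v
  simp only [smul_eq_mul, ← mul_assoc]
  rw [← Complex.exp_add]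
  congr 2
  simp only [RCLike.inner_apply, conj_trivial]
  have : ((x - x₁) / ρ) * (ρ * v) = (x - x₁) * v := by field_simp
  rw [this]
  push_cast
  ring

theorem lintegral_inv_Ioo {r : ℝ} (hr : 0 < r) (n : ℕ) :
    ∫⁻ ξ in Ioo (1 / r) (2 ^ n / r), ENNReal.ofReal (1 / ξ) ≤ n := by
  have h1 : 1 / r ≤ 2 ^ n / r := by gcongr; exact one_le_pow₀ (by norm_num)
  have h0 : 0 < 1 / r := by positivity
  have hpos : ∀ ξ ∈ Icc (1 / r) (2 ^ n / r), ξ ≠ 0 := fun ξ hξ => (h0.trans_le hξ.1).ne'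
  have hint : IntervalIntegrable (fun ξ : ℝ => 1 / ξ) volume (1 / r) (2 ^ n / r) := by
    apply ContinuousOn.intervalIntegrable
    rw [uIcc_of_le h1]
    exact continuousOn_const.div continuousOn_id hpos
  have hint' : IntegrableOn (fun ξ : ℝ => 1 / ξ) (Ioo (1 / r) (2 ^ n / r)) :=
    ((intervalIntegrable_iff_integrableOn_Ioc_of_le h1).1 hint).mono_set Ioo_subset_Ioc_self
  rw [← ofReal_integral_eq_lintegral_ofReal hint' (by
      filter_upwards [ae_restrict_mem measurableSet_Ioo] with ξ hξ
      have := h0.trans hξ.1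
      positivity), ← integral_Ioc_eq_integral_Ioo, ← intervalIntegral.integral_of_le h1,
    integral_one_div_of_pos h0 (h0.trans_le h1)]
  have : (2 ^ n / r) / (1 / r) = 2 ^ n := by field_simp
  rw [this, Real.log_pow, ← ENNReal.ofReal_natCast]
  apply ENNReal.ofReal_le_ofReal
  have := Real.log_two_lt_d9
  nlinarith [(Nat.cast_nonneg n : (0 : ℝ) ≤ n)]

/-- The Cauchy–Schwarz inequality over the frequencies between `1 / r` and `2 ^ n / r`. -/
theorem lintegral_enorm_Ioo_le {F : Type*} [NormedAddCommGroup F] {g : ℝ → F} {r : ℝ} (hr : 0 < r)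
    (hg : AEStronglyMeasurable g) (n : ℕ) :
    ∫⁻ ξ in Ioo (1 / r) (2 ^ n / r), ‖g ξ‖ₑ ≤
      (∫⁻ ξ, ENNReal.ofReal (|ξ| ^ (2 * (1 / 2 : ℝ))) * ‖g ξ‖ₑ ^ 2) ^ (1 / 2 : ℝ)
        * (n : ℝ≥0∞) ^ (1 / 2 : ℝ) := by
  have h0 : 0 < 1 / r := by positivity
  have hH := ENNReal.lintegral_mul_le_Lp_mul_Lq (volume.restrict (Ioo (1 / r) (2 ^ n / r)))
    (p := 2) (q := 2) Real.HolderConjugate.two_two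
    (f := fun ξ => ENNReal.ofReal √|ξ| * ‖g ξ‖ₑ) (g := fun ξ => ENNReal.ofReal (√|ξ|)⁻¹)
    ((by fun_prop : Measurable fun ξ : ℝ => ENNReal.ofReal √|ξ|).aemeasurable.mul
      hg.restrict.enorm) (by fun_prop)
  calc ∫⁻ ξ in Ioo (1 / r) (2 ^ n / r), ‖g ξ‖ₑ
      = ∫⁻ ξ in Ioo (1 / r) (2 ^ n / r), ((fun ξ => ENNReal.ofReal √|ξ| * ‖g ξ‖ₑ)
          * fun ξ => ENNReal.ofReal (√|ξ|)⁻¹) ξ := by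
        refine setLIntegral_congr_fun measurableSet_Ioo fun ξ hξ => ?_
        have hs : 0 < √|ξ| := Real.sqrt_pos.2 (abs_pos.2 (h0.trans hξ.1).ne')
        simp only [Pi.mul_apply]
        rw [mul_right_comm, ← ENNReal.ofReal_mul hs.le, mul_inv_cancel₀ hs.ne', ENNReal.ofReal_one,
          one_mul]
    _ ≤ _ := hH
    _ ≤ _ := by
        gcongr ?_ ^ _ * ?_ ^ _
        · refine (lintegral_mono fun ξ => ?_).trans (setLIntegral_le_lintegral _ _)
          rw [ENNReal.mul_rpow_of_nonneg _ _ (by norm_num), ENNReal.rpow_ofNat, ENNReal.rpow_ofNat,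
            ← ENNReal.ofReal_pow (Real.sqrt_nonneg _), Real.sq_sqrt (abs_nonneg _)]
          norm_num
        · refine le_trans (le_of_eq ?_) (lintegral_inv_Ioo hr n)
          refine setLIntegral_congr_fun measurableSet_Ioo fun ξ hξ => ?_
          have hξ0 := h0.trans hξ.1
          rw [ENNReal.rpow_ofNat, ← ENNReal.ofReal_pow (by positivity), inv_pow,
            Real.sq_sqrt (abs_nonneg _), abs_of_pos hξ0, one_div]

theorem hDotNorm_congr_ae {m : ℕ} {s : ℝ} {f f' : ℝ → Amb m} (h : f =ᵐ[volume] f') :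
    hDotNorm s f = hDotNorm s f' := by
  have key : ∀ {f f' : ℝ → Amb m}, f =ᵐ[volume] f' → ∀ g, IsFourierOffZero f g →
      IsFourierOffZero f' g := fun h g hg => by
    refine ⟨(memLp_congr_ae h).1 hg.bounded, hg.locallyIntegrable, fun ψ h1 h2 i => ?_⟩
    rw [← hg.pairing ψ h1 h2 i]
    refine integral_congr_ae ?_
    filter_upwards [h] with x hx
    rw [hx]
  unfold hDotNorm
  congr 1
  funext g
  rw [show IsFourierOffZero f g = IsFourierOffZero f' g from
    propext ⟨key h g, key h.symm g⟩]

/-- Testing `f` against the dilate of the profile `ψ` by `ρ`, centred at `x₁`. -/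
theorem exists_dilated_test (ψ : 𝓢(ℝ, ℂ)) (hsupp : Function.support ψ ⊆ Ioo 1 2)
    (x₁ : ℝ) {ρ : ℝ} (hρ : 0 < ρ) :
    ∃ ψ' : 𝓢(ℝ, ℂ), HasCompactSupport ψ' ∧ (0 : ℝ) ∉ tsupport ψ' ∧
      (∀ ξ, ‖ψ' ξ‖ = ‖ψ (ρ * ξ)‖) ∧
      ∀ h : ℝ → ℝ, ∫ x, (h x : ℂ) * (𝓕 ψ') x = ∫ y, (h (x₁ + ρ * y) : ℂ) * (𝓕 ψ) y := by
  set F : ℝ → ℂ := fun ξ : ℝ => Complex.exp (↑(2 * Real.pi * x₁ * ξ) * Complex.I) * ψ (ρ * ξ)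
    with hF
  have hnorm : ∀ ξ, ‖F ξ‖ = ‖ψ (ρ * ξ)‖ := fun ξ => by
    rw [hF, norm_mul, Complex.norm_exp_ofReal_mul_I, one_mul]
  have hFs : Function.support F ⊆ Icc (1 / ρ) (2 / ρ) := fun ξ hξ => by
    have h1 : ψ (ρ * ξ) ≠ 0 := by
      rw [← norm_ne_zero_iff, ← hnorm]; exact norm_ne_zero_iff.2 hξ
    have h2 := hsupp h1
    exact ⟨by rw [div_le_iff₀ hρ]; linarith [h2.1], by rw [le_div_iff₀ hρ]; linarith [h2.2]⟩
  have hFsm : ContDiff ℝ ∞ F := by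
    have h1 : ContDiff ℝ ∞ (fun x : ℝ => (x : ℂ)) := Complex.ofRealCLM.contDiff
    have h2 : ContDiff ℝ ∞ ψ := ψ.smooth _
    have h3 : ContDiff ℝ ∞ fun ξ : ℝ => ((2 * Real.pi * x₁ * ξ : ℝ) : ℂ) := h1.comp (by fun_prop)
    have h4 : ContDiff ℝ ∞ fun ξ : ℝ => ψ (ρ * ξ) := h2.comp (by fun_prop)
    exact ((h3.mul contDiff_const).cexp).mul h4
  have hFc : HasCompactSupport F := HasCompactSupport.intro' isCompact_Icc isClosed_Icc
    fun x hx => by_contra fun h => hx (hFs h)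
  obtain ⟨ψ', hψ'⟩ := exists_schwartz_of_hasCompactSupport hFc hFsm
  have hco : (ψ' : ℝ → ℂ) = F := funext hψ'
  refine ⟨ψ', by rwa [hco], ?_, fun ξ => by rw [hψ', hnorm], fun h => ?_⟩
  · rw [hco]
    intro h0
    have := (closure_minimal hFs isClosed_Icc) h0
    exact absurd this.1 (not_le.2 (by positivity))
  · have h1 : ∀ x, (𝓕 ψ' : 𝓢(ℝ, ℂ)) x = (ρ⁻¹ : ℝ) • (𝓕 ψ : 𝓢(ℝ, ℂ)) ((x - x₁) / ρ) := fun x => by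
      rw [SchwartzMap.fourier_coe, SchwartzMap.fourier_coe, hco, hF, fourier_modulate_dilate _ _ hρ]
    have h2 := Measure.integral_comp_mul_left
      (fun z => (h (x₁ + z) : ℂ) * (𝓕 ψ : 𝓢(ℝ, ℂ)) (z / ρ)) ρ
    rw [abs_of_pos (inv_pos.2 hρ)] at h2
    have h3 := integral_add_left_eq_self
      (fun x => (h x : ℂ) * (𝓕 ψ : 𝓢(ℝ, ℂ)) ((x - x₁) / ρ)) x₁ (μ := volume)
    simp only [mul_div_cancel_left₀ _ hρ.ne'] at h2
    simp only [add_sub_cancel_left] at h3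
    rw [h2, h3, ← integral_smul]
    congr 1
    funext x
    rw [h1, mul_smul_comm]

/-- A bounded function which jumps from `p` to `q` at scale `2⁻ⁿ r`, and is constant on both sides
up to the scale `r`, has `Ḣ^{1/2}` norm at least of order `|q - p| √n`: each of the `n` dyadic
scales in between contributes `|q - p|²` to the square of the norm. -/
theorem exists_le_hDotNorm_of_jump : ∃ A : ℝ, 0 < A ∧
    ∀ {m : ℕ} {f : ℝ → Amb m} {i : Fin m} {M p q x₁ r : ℝ} {n : ℕ}, 0 < r → 1 ≤ n →
      (∀ᵐ x, ‖f x‖ ≤ M) → |p| ≤ M → |q| ≤ M → (∀ x ∈ Icc (x₁ - r) x₁, f x i = p) →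
      (∀ x ∈ Icc (x₁ + r / 2 ^ n) (x₁ + r), f x i = q) →
      ENNReal.ofReal (A * |q - p| * √n - M) ≤ hDotNorm (1 / 2) f := by
  obtain ⟨ψ, A, hA0, hsupp, hA, hA'⟩ := exists_band_limited_profile
  set η : 𝓢(ℝ, ℂ) := 𝓕 ψ with hη
  obtain ⟨M₀, hM₀p, hM₀⟩ := η.decay 0 0
  obtain ⟨M₂, hM₂p, hM₂⟩ := ψ.decay 0 0
  simp only [pow_zero, one_mul, norm_iteratedFDeriv_zero] at hM₀ hM₂
  have hη1 : Integrable fun y => |y| * ‖η y‖ := by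
    simpa using η.integrable_pow_mul volume 1
  set M₁ := ∫ y, |y| * ‖η y‖ with hM₁
  have hM₁0 : 0 ≤ M₁ := integral_nonneg fun y => by positivity
  -- `C` dominates both the size of the test functions and the errors
  set C : ℝ := M₂ + 2 * (M₀ + 2 * M₁) with hC
  have hCp : 0 < C := by positivity
  refine ⟨‖A‖ / C, div_pos (norm_pos_iff.2 hA0) hCp, ?_⟩
  intro m f i M p q x₁ r n hr hn hM hpM hqM hp hq
  have hM0 : 0 ≤ M := (abs_nonneg p).trans hpM
  refine le_iInf₂ fun g hg => ?_
  set H := (∫⁻ ξ, ENNReal.ofReal (|ξ| ^ (2 * (1 / 2 : ℝ))) * ‖g ξ‖ₑ ^ 2) ^ (1 / 2 : ℝ) with hH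
  have hgm : AEStronglyMeasurable g := by
    have := hg.locallyIntegrable.aestronglyMeasurable
    rwa [Measure.restrict_eq_self_of_ae_mem] at this
    exact compl_mem_ae_iff.2 (by simp)
  have hfm : AEStronglyMeasurable (fun x => f x i) :=
    (EuclideanSpace.proj (𝕜 := ℝ) i).continuous.comp_aestronglyMeasurable hg.bounded.1
  have hρ : ∀ j : ℕ, 0 < r / 2 ^ j := fun j => by positivity
  choose ψ' h1 h2 h3 h4 using fun j : ℕ => exists_dilated_test ψ hsupp x₁ (hρ j)
  -- lower bound for each pairing
  have hlow : ∀ j ∈ Finset.range n, |q - p| * ‖A‖ - 2 * M * (2 ^ j / 2 ^ n * M₀ + M₁ / 2 ^ j) ≤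
      ‖∫ ξ, g ξ i * ψ' j ξ‖ := fun j hj => by
    have hj' := Finset.mem_range.1 hj
    rw [← hg.pairing (ψ' j) (h1 j) (h2 j) i, h4 j fun x => f x i]
    have hmap : Measure.QuasiMeasurePreserving (fun y : ℝ => x₁ + r / 2 ^ j * y) volume volume := by
      have e1 : Measure.QuasiMeasurePreserving (fun y : ℝ => r / 2 ^ j * y) volume volume :=
        ⟨by fun_prop, by
          rw [Real.map_volume_mul_left (hρ j).ne']
          exact Measure.smul_absolutelyContinuous⟩
      exact (measurePreserving_add_left volume x₁).quasiMeasurePreserving.comp e1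
    have hb := norm_integral_mul_sub_step_le (η := η) (A := A) (M₀ := M₀) (M := M) (p := p) (q := q)
      (a := 2 ^ j) (b := 2 ^ j / 2 ^ n) (h := fun y => f (x₁ + r / 2 ^ j * y) i)
      η.integrable hη1 hA hA' hM₀ (by positivity) (by positivity)
      (hfm.comp_quasiMeasurePreserving hmap)
      (by
        filter_upwards [hmap.ae hM] with y hy
        exact (PiLp.norm_apply_le _ i).trans hy) hpM hqM
      (fun y hy => hp _ ⟨by
          have := mul_le_mul_of_nonneg_left hy.1 (hρ j).le
          rw [mul_neg, div_mul_cancel₀ _ (by positivity)] at this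
          linarith, by nlinarith [hy.2, hρ j]⟩)
      (fun y hy => hq _ ⟨by
          have := mul_le_mul_of_nonneg_left hy.1 (hρ j).le
          rw [div_mul_div_cancel₀ (by positivity)] at this
          linarith, by
          have := mul_le_mul_of_nonneg_left hy.2 (hρ j).le
          rw [div_mul_cancel₀ _ (by positivity)] at this
          linarith⟩)
    have hn : ‖((q : ℂ) - p) * A‖ = |q - p| * ‖A‖ := by
      rw [norm_mul, ← Complex.ofReal_sub, Complex.norm_real, Real.norm_eq_abs]
    have := norm_sub_norm_le (((q : ℂ) - p) * A) (∫ y, (f (x₁ + r / 2 ^ j * y) i : ℂ) * η y)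
    rw [norm_sub_rev, hn] at this
    linarith
  -- the sum of the lower bounds
  have hsum : n * (|q - p| * ‖A‖) - C * M ≤ ∑ j ∈ Finset.range n, ‖∫ ξ, g ξ i * ψ' j ξ‖ := by
    refine le_trans ?_ (Finset.sum_le_sum hlow)
    rw [Finset.sum_sub_distrib, Finset.sum_const, Finset.card_range, nsmul_eq_mul,
      ← Finset.mul_sum, Finset.sum_add_distrib, ← Finset.sum_mul, ← Finset.sum_div]
    have g1 : (∑ j ∈ Finset.range n, (2 : ℝ) ^ j) / 2 ^ n ≤ 1 := by
      rw [geom_sum_eq (by norm_num), div_le_one (by positivity)]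
      norm_num
    have g2 : ∑ j ∈ Finset.range n, M₁ / (2 : ℝ) ^ j ≤ M₁ * 2 := by
      simp only [div_eq_mul_inv, ← Finset.mul_sum, ← inv_pow]
      refine mul_le_mul_of_nonneg_left ?_ hM₁0
      rw [geom_sum_eq (by norm_num)]
      have : (0 : ℝ) < 2⁻¹ ^ n := by positivity
      rw [div_le_iff_of_neg (by norm_num)]
      linarith
    have g3 : (∑ j ∈ Finset.range n, (2 : ℝ) ^ j) / 2 ^ n * M₀ ≤ 1 * M₀ :=
      mul_le_mul_of_nonneg_right g1 hM₀p.le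
    have g4 : 2 * M * ((∑ j ∈ Finset.range n, (2 : ℝ) ^ j) / 2 ^ n * M₀
        + ∑ j ∈ Finset.range n, M₁ / (2 : ℝ) ^ j) ≤ 2 * M * (1 * M₀ + M₁ * 2) :=
      mul_le_mul_of_nonneg_left (add_le_add g3 g2) (by positivity)
    have g5 : 0 ≤ M₂ * M := by positivity
    simp only [hC]
    linarith
  -- upper bound: the test functions live on disjoint dyadic frequency bands
  set J : ℕ → Set ℝ := fun j => Ioo (2 ^ j / r) (2 ^ (j + 1) / r) with hJ
  have hup : ∀ j, ‖∫ ξ, g ξ i * ψ' j ξ‖ₑ ≤ ENNReal.ofReal M₂ * ∫⁻ ξ in J j, ‖g ξ‖ₑ := fun j => by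
    refine (enorm_integral_le_lintegral_enorm _).trans ?_
    rw [← lintegral_const_mul'' _ hgm.restrict.enorm, ← lintegral_indicator measurableSet_Ioo]
    refine lintegral_mono fun ξ => ?_
    by_cases hξ : ξ ∈ J j
    · rw [indicator_of_mem hξ, enorm_mul, mul_comm]
      gcongr
      · rw [← ofReal_norm, h3]
        exact ENNReal.ofReal_le_ofReal (hM₂ _)
      · rw [← ofReal_norm, ← ofReal_norm]
        exact ENNReal.ofReal_le_ofReal (PiLp.norm_apply_le _ i)
    · have : ψ' j ξ = 0 := by
        rw [← norm_eq_zero, h3, norm_eq_zero]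
        by_contra h
        have h5 := hsupp h
        apply hξ
        have h6 := h5.1
        have h7 := h5.2
        rw [div_mul_eq_mul_div, lt_div_iff₀ (by positivity)] at h6
        rw [div_mul_eq_mul_div, div_lt_iff₀ (by positivity)] at h7
        exact ⟨by rw [div_lt_iff₀ hr]; linarith, by rw [lt_div_iff₀ hr, pow_succ]; linarith⟩
      rw [this, mul_zero, enorm_zero]
      exact zero_le
  have hdisj : Pairwise (Function.onFun Disjoint J) := by
    have hmono : ∀ a b : ℕ, a < b → Disjoint (J a) (J b) := fun a b hab => by
      rw [Set.disjoint_left]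
      intro x hx hx'
      have : (2 : ℝ) ^ (a + 1) / r ≤ 2 ^ b / r := by
        gcongr
        · norm_num
        · exact hab
      linarith [hx.2, hx'.1]
    intro a b hab
    rcases lt_or_gt_of_ne hab with h | h
    · exact hmono a b h
    · exact (hmono b a h).symm
  have hsub : (⋃ j ∈ Finset.range n, J j) ⊆ Ioo (1 / r) (2 ^ n / r) := by
    intro x hx
    simp only [mem_iUnion, Finset.mem_range] at hx
    obtain ⟨j, hj, hx1, hx2⟩ := hx
    refine ⟨lt_of_le_of_lt ?_ hx1, lt_of_lt_of_le hx2 ?_⟩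
    · gcongr; exact one_le_pow₀ (by norm_num)
    · gcongr
      · norm_num
      · exact hj
  have hupper : ENNReal.ofReal (n * (|q - p| * ‖A‖) - C * M) ≤
      ENNReal.ofReal C * (H * (n : ℝ≥0∞) ^ (1 / 2 : ℝ)) := by
    calc _ ≤ ENNReal.ofReal (∑ j ∈ Finset.range n, ‖∫ ξ, g ξ i * ψ' j ξ‖) :=
          ENNReal.ofReal_le_ofReal hsum
      _ = ∑ j ∈ Finset.range n, ‖∫ ξ, g ξ i * ψ' j ξ‖ₑ := by
          rw [ENNReal.ofReal_sum_of_nonneg fun j _ => norm_nonneg _]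
          simp only [ofReal_norm]
      _ ≤ ∑ j ∈ Finset.range n, ENNReal.ofReal M₂ * ∫⁻ ξ in J j, ‖g ξ‖ₑ :=
          Finset.sum_le_sum fun j _ => hup j
      _ = ENNReal.ofReal M₂ * ∫⁻ ξ in ⋃ j ∈ Finset.range n, J j, ‖g ξ‖ₑ := by
          rw [← Finset.mul_sum, lintegral_biUnion_finset (hdisj.set_pairwise _)
            fun j _ => measurableSet_Ioo]
      _ ≤ ENNReal.ofReal C * (H * (n : ℝ≥0∞) ^ (1 / 2 : ℝ)) := by
          gcongr
          · rw [hC]; linarith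
          · exact (lintegral_mono_set hsub).trans (lintegral_enorm_Ioo_le hr hgm n)
  -- divide by `C √n`
  have hn0 : (1 : ℝ) ≤ n := by exact_mod_cast hn
  have hsq : 1 ≤ √(n : ℝ) := Real.one_le_sqrt.2 hn0
  have hsqn : √(n : ℝ) * √n = n := Real.mul_self_sqrt (by linarith)
  have hrp : (n : ℝ≥0∞) ^ (1 / 2 : ℝ) = ENNReal.ofReal √n := by
    rw [← ENNReal.ofReal_natCast, ENNReal.ofReal_rpow_of_nonneg (by linarith) (by norm_num),
      Real.sqrt_eq_rpow]
  rw [hrp] at hupper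
  have hfin : ENNReal.ofReal (C * √n) * ENNReal.ofReal (‖A‖ / C * |q - p| * √n - M) ≤
      ENNReal.ofReal (C * √n) * H := by
    rw [← ENNReal.ofReal_mul (by positivity)]
    calc _ ≤ ENNReal.ofReal (n * (|q - p| * ‖A‖) - C * M) := by
          apply ENNReal.ofReal_le_ofReal
          have e1 : C * √n * (‖A‖ / C * |q - p| * √n - M)
              = (√n * √n) * (|q - p| * ‖A‖) - C * M * √n := by field_simp
          rw [e1, hsqn]
          have : C * M * 1 ≤ C * M * √n := mul_le_mul_of_nonneg_left hsq (by positivity)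
          linarith
      _ ≤ _ := hupper
      _ = _ := by rw [ENNReal.ofReal_mul hCp.le]; ring
  exact (ENNReal.mul_le_mul_iff_right (ENNReal.ofReal_pos.2 (by positivity)).ne'
    ENNReal.ofReal_ne_top).1 hfin

/-! ### The Besov norm of a superposition of rescaled bumps -/

theorem iUnion_dyadic_annuli :
    (⋃ j : ℤ, {ξ : ℝ | (2 : ℝ) ^ j ≤ |ξ| ∧ |ξ| < (2 : ℝ) ^ (j + 1)}) = {0}ᶜ := by
  ext ξ
  simp only [mem_iUnion, mem_ofPred_eq, mem_compl_iff, mem_singleton_iff]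
  constructor
  · rintro ⟨j, h1, -⟩ rfl
    rw [abs_zero] at h1
    exact absurd h1 (not_le.2 (by positivity))
  · intro h
    exact exists_mem_Ico_zpow (abs_pos.2 h) one_lt_two

theorem measurableSet_dyadic_annulus (j : ℤ) :
    MeasurableSet {ξ : ℝ | (2 : ℝ) ^ j ≤ |ξ| ∧ |ξ| < (2 : ℝ) ^ (j + 1)} :=
  (measurableSet_le measurable_const continuous_abs.measurable).inter
    (measurableSet_lt continuous_abs.measurable measurable_const)

theorem hDotNorm_half_le_besovNorm {m : ℕ} (f : ℝ → Amb m) :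
    hDotNorm (1 / 2) f ≤ 2 * besovNorm (1 / 2) f := by
  rw [mul_comm, ← ENNReal.div_le_iff_le_mul (by simp) (by simp)]
  refine le_iInf₂ fun g hg => ?_
  rw [ENNReal.div_le_iff_le_mul (by simp) (by simp)]
  refine (iInf₂_le g hg).trans ?_
  set a : ℤ → ℝ≥0∞ := fun j => ENNReal.ofReal ((2 : ℝ) ^ ((j : ℝ) * (1 / 2))) *
      (∫⁻ ξ in {ξ : ℝ | (2 : ℝ) ^ j ≤ |ξ| ∧ |ξ| < (2 : ℝ) ^ (j + 1)}, ‖g ξ‖ₑ ^ 2) ^ (1 / 2 : ℝ)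
    with ha
  have hsq : ∀ j, ∫⁻ ξ in {ξ : ℝ | (2 : ℝ) ^ j ≤ |ξ| ∧ |ξ| < (2 : ℝ) ^ (j + 1)},
      ENNReal.ofReal (|ξ| ^ (2 * (1 / 2 : ℝ))) * ‖g ξ‖ₑ ^ 2 ≤ 2 * a j ^ 2 := fun j => by
    have h2 : (2 : ℝ≥0∞) * a j ^ 2 = ENNReal.ofReal (2 ^ (j + 1)) *
        ∫⁻ ξ in {ξ : ℝ | (2 : ℝ) ^ j ≤ |ξ| ∧ |ξ| < (2 : ℝ) ^ (j + 1)}, ‖g ξ‖ₑ ^ 2 := by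
      rw [ha, mul_pow, ← ENNReal.rpow_natCast (_ ^ (1 / 2 : ℝ)) 2, ← ENNReal.rpow_mul,
        ← ENNReal.ofReal_pow (by positivity), ← mul_assoc, ← Real.rpow_natCast (_ ^ _) 2,
        ← Real.rpow_mul (by norm_num)]
      norm_num
      rw [zpow_add_one₀ (by norm_num), mul_comm ((2 : ℝ) ^ j), ENNReal.ofReal_mul (by norm_num)]
      simp
    rw [h2, ← lintegral_const_mul' _ _ (by simp)]
    refine setLIntegral_mono_ae' ?_ (Eventually.of_forall fun ξ hξ => ?_)
    · exact measurableSet_dyadic_annulus j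
    · gcongr
      norm_num
      exact hξ.2.le
  have hle : ∫⁻ ξ, ENNReal.ofReal (|ξ| ^ (2 * (1 / 2 : ℝ))) * ‖g ξ‖ₑ ^ 2 ≤ (2 * ∑' j, a j) ^ 2 := by
    calc _ = ∫⁻ ξ in ⋃ j : ℤ, {ξ : ℝ | (2 : ℝ) ^ j ≤ |ξ| ∧ |ξ| < (2 : ℝ) ^ (j + 1)},
          ENNReal.ofReal (|ξ| ^ (2 * (1 / 2 : ℝ))) * ‖g ξ‖ₑ ^ 2 := by
          rw [iUnion_dyadic_annuli, restrict_compl_singleton]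
      _ ≤ ∑' j, 2 * a j ^ 2 := (lintegral_iUnion_le _ _).trans (ENNReal.tsum_le_tsum hsq)
      _ ≤ ∑' j, 2 * ((∑' j, a j) * a j) := by
          refine ENNReal.tsum_le_tsum fun j => ?_
          rw [sq]
          gcongr
          exact ENNReal.le_tsum j
      _ = 2 * (∑' j, a j) ^ 2 := by rw [ENNReal.tsum_mul_left, ENNReal.tsum_mul_left, sq]
      _ ≤ 4 * (∑' j, a j) ^ 2 := by gcongr; norm_num
      _ = _ := by rw [mul_pow]; norm_num
  calc _ ≤ ((2 * ∑' j, a j) ^ 2) ^ (1 / 2 : ℝ) := ENNReal.rpow_le_rpow hle (by norm_num)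
    _ = 2 * ∑' j, a j := by
        rw [← ENNReal.rpow_natCast, ← ENNReal.rpow_mul]; norm_num
    _ = _ := mul_comm _ _

/-- Pointwise bounds on the dyadic annuli bound the Besov norm of order `1/2`. -/
theorem besovNorm_half_le_tsum {m : ℕ} {f : ℝ → Amb m} {g : ℝ → EuclideanSpace ℂ (Fin m)}
    (hg : IsFourierOffZero f g) {B : ℤ → ℝ≥0∞}
    (hB : ∀ (j : ℤ) (ξ : ℝ), (2 : ℝ) ^ j ≤ |ξ| → ‖g ξ‖ₑ ≤ B j) :
    besovNorm (1 / 2) f ≤ ∑' j : ℤ, 2 * (ENNReal.ofReal ((2 : ℝ) ^ j) * B j) := by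
  refine (iInf₂_le g hg).trans (ENNReal.tsum_le_tsum fun j => ?_)
  set S : Set ℝ := {ξ : ℝ | (2 : ℝ) ^ j ≤ |ξ| ∧ |ξ| < (2 : ℝ) ^ (j + 1)} with hS
  have hvol : volume S ≤ ENNReal.ofReal (4 * 2 ^ j) := by
    have : S ⊆ Icc (-(2 ^ (j + 1))) (2 ^ (j + 1)) := fun ξ hξ => abs_le.1 hξ.2.le
    refine (measure_mono this).trans (le_of_eq ?_)
    rw [Real.volume_Icc, zpow_add_one₀ (by norm_num)]
    ring_nf
  have hint : ∫⁻ ξ in S, ‖g ξ‖ₑ ^ 2 ≤ B j ^ 2 * ENNReal.ofReal (4 * 2 ^ j) := by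
    calc _ ≤ ∫⁻ _ in S, B j ^ 2 := by
          refine setLIntegral_mono_ae' ?_ (Eventually.of_forall fun ξ hξ => ?_)
          · exact measurableSet_dyadic_annulus j
          · gcongr
            exact hB j ξ hξ.1
      _ = B j ^ 2 * volume S := by simp
      _ ≤ _ := by gcongr
  have hp : (0 : ℝ) < 2 ^ j := by positivity
  calc _ ≤ ENNReal.ofReal ((2 : ℝ) ^ ((j : ℝ) * (1 / 2))) *
        (B j ^ 2 * ENNReal.ofReal (4 * 2 ^ j)) ^ (1 / 2 : ℝ) := by gcongr
    _ = _ := by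
      rw [ENNReal.mul_rpow_of_nonneg _ _ (by norm_num), ← ENNReal.rpow_natCast, ← ENNReal.rpow_mul,
        ENNReal.ofReal_rpow_of_nonneg (by positivity) (by norm_num), ← Real.sqrt_eq_rpow,
        show (2 : ℝ) ^ ((j : ℝ) * (1 / 2)) = √(2 ^ j) by
          rw [Real.rpow_mul (by norm_num), Real.rpow_intCast, Real.sqrt_eq_rpow],
        show √(4 * (2 : ℝ) ^ j) = 2 * √(2 ^ j) by
          rw [show (4 : ℝ) = 2 ^ 2 by norm_num, Real.sqrt_mul (by norm_num),
            Real.sqrt_sq (by norm_num)],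
        ENNReal.ofReal_mul (by norm_num)]
      norm_num
      rw [show ENNReal.ofReal √(2 ^ j) * (B j * (2 * ENNReal.ofReal √(2 ^ j)))
        = 2 * (ENNReal.ofReal √(2 ^ j) * ENNReal.ofReal √(2 ^ j) * B j) by ring,
        ← ENNReal.ofReal_mul (by positivity), Real.mul_self_sqrt hp.le]

theorem continuous_fourier_of_integrable {f : ℝ → ℂ} (hf : Integrable f) : Continuous (𝓕 f) :=
  VectorFourier.fourierIntegral_continuous Real.continuous_fourierChar continuous_inner hf

theorem integral_fourier_schwartz {ψ : 𝓢(ℝ, ℂ)} : ∫ x, (𝓕 ψ) x = ψ 0 := by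
  have h : (𝓕⁻ (𝓕 ψ) : 𝓢(ℝ, ℂ)) 0 = ψ 0 := by rw [FourierTransform.fourierInv_fourier_eq]
  rw [SchwartzMap.fourierInv_coe, Real.fourierInv_eq] at h
  simpa using h

/-- The Fourier transform of an integrable function is also the Fourier transform off zero of its
sum with a constant. -/
theorem isFourierOffZero_of_integrable {m : ℕ} {f : ℝ → Amb m} {c : Amb m} {F : Fin m → ℝ → ℂ}
    (hf : MemLp f ⊤ volume) (hF : ∀ i, Integrable (F i)) (h : ∀ x i, (f x i : ℂ) = c i + F i x) :
    IsFourierOffZero f (fun ξ => WithLp.toLp 2 fun i => 𝓕 (F i) ξ) := by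
  refine ⟨hf, ?_, fun ψ _ h0 i => ?_⟩
  · have : Continuous fun ξ => (WithLp.toLp 2 fun i => 𝓕 (F i) ξ : EuclideanSpace ℂ (Fin m)) :=
      (PiLp.continuous_toLp 2 _).comp
        (continuous_pi fun i => continuous_fourier_of_integrable (hF i))
    exact this.locallyIntegrable.locallyIntegrableOn _
  · have hψ0 : ψ 0 = 0 := image_eq_zero_of_notMem_tsupport h0
    have e1 : ∫ ξ, 𝓕 (F i) ξ * ψ ξ = ∫ x, F i x * (𝓕 ψ) x := by
      rw [SchwartzMap.fourier_coe]
      simpa using! VectorFourier.integral_fourierIntegral_smul_eq_flip (L := innerₗ ℝ)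
        Real.continuous_fourierChar continuous_inner (hF i) ψ.integrable
    have hb : Integrable fun x => F i x * (𝓕 ψ : 𝓢(ℝ, ℂ)) x := by
      obtain ⟨C, -, hC⟩ := (𝓕 ψ : 𝓢(ℝ, ℂ)).decay 0 0
      refine (hF i).mul_bdd (c := C) (𝓕 ψ : 𝓢(ℝ, ℂ)).continuous.aestronglyMeasurable
        (Eventually.of_forall fun x => by simpa using hC x)
    simp only [h, add_mul]
    rw [e1, integral_add ((𝓕 ψ : 𝓢(ℝ, ℂ)).integrable.const_mul _) hb, integral_const_mul,
      integral_fourier_schwartz, hψ0, mul_zero, zero_add]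

theorem fourier_dilate_translate (w : ℝ → ℂ) (x₀ : ℝ) {l : ℝ} (hl : 0 < l) (ξ : ℝ) :
    ‖𝓕 (fun x => w (l * (x - x₀))) ξ‖ = l⁻¹ * ‖𝓕 w (ξ / l)‖ := by
  rw [Real.fourier_eq', Real.fourier_eq']
  set G : ℝ → ℂ := fun v => Complex.exp (↑(-2 * Real.pi * inner ℝ v (ξ / l)) * Complex.I) • w v
  have h1 := Measure.integral_comp_mul_left G l
  rw [abs_of_pos (inv_pos.2 hl)] at h1
  have h2 := integral_sub_right_eq_self (fun x => G (l * x)) x₀ (μ := volume)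
  have h3 : ∀ v, Complex.exp (↑(-2 * Real.pi * inner ℝ v ξ) * Complex.I) • w (l * (v - x₀)) =
      Complex.exp (↑(-2 * Real.pi * (x₀ * ξ)) * Complex.I) * G (l * (v - x₀)) := fun v => by
    simp only [G, smul_eq_mul]
    rw [← mul_assoc, ← Complex.exp_add, ← add_mul, ← Complex.ofReal_add]
    congr 4
    simp only [RCLike.inner_apply, conj_trivial]
    field_simp
    ring
  simp only [h3]
  rw [integral_const_mul, h2, h1, norm_mul, Complex.norm_exp_ofReal_mul_I, one_mul, norm_smul,
    Real.norm_of_nonneg (inv_pos.2 hl).le]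

/-- A bump of width `2⁻ⁿ` has its Besov norm concentrated at the frequencies of size `2ⁿ`. -/
theorem fourier_dilate_translate_le {w : ℝ → ℂ} {K : ℝ} (h1 : ∀ ξ, ‖𝓕 w ξ‖ ≤ K)
    (h2 : ∀ ξ, ξ ^ 2 * ‖𝓕 w ξ‖ ≤ K) (x₀ : ℝ) (n : ℕ) {j : ℤ} {ξ : ℝ} (hξ : (2 : ℝ) ^ j ≤ |ξ|) :
    2 ^ j * ‖𝓕 (fun x => w (2 ^ n * (x - x₀))) ξ‖ ≤ K * (2 : ℝ)⁻¹ ^ (j - n).natAbs := by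
  rw [fourier_dilate_translate w x₀ (by positivity)]
  have hK : 0 ≤ K := (norm_nonneg _).trans (h1 0)
  rcases le_total j n with hj | hj
  · have e : (2 : ℝ)⁻¹ ^ (j - n).natAbs = 2 ^ j * (2 ^ n)⁻¹ := by
      rw [← zpow_natCast, Int.natCast_natAbs, abs_of_nonpos (by linarith), inv_zpow', neg_neg,
        zpow_sub₀ (by norm_num), zpow_natCast]
      rfl
    rw [e]
    calc _ = 2 ^ j * (2 ^ n)⁻¹ * ‖𝓕 w (ξ / 2 ^ n)‖ := by ring
      _ ≤ 2 ^ j * (2 ^ n)⁻¹ * K := by gcongr; exact h1 _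
      _ = _ := by ring
  · have e : (2 : ℝ)⁻¹ ^ (j - n).natAbs = (2 ^ j)⁻¹ * 2 ^ n := by
      rw [← zpow_natCast, Int.natCast_natAbs, abs_of_nonneg (by linarith), inv_zpow', neg_sub,
        zpow_sub₀ (by norm_num), zpow_natCast, div_eq_mul_inv, mul_comm]
    rw [e]
    have hp : (0 : ℝ) < 2 ^ j := by positivity
    have h3 := h2 (ξ / 2 ^ n)
    have h4 : ((2 : ℝ) ^ j / 2 ^ n) ^ 2 * ‖𝓕 w (ξ / 2 ^ n)‖ ≤ K := by
      refine le_trans ?_ h3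
      rw [div_pow, div_pow, ← sq_abs ξ]
      gcongr
    calc 2 ^ j * ((2 ^ n)⁻¹ * ‖𝓕 w (ξ / 2 ^ n)‖)
        = (((2 : ℝ) ^ j / 2 ^ n) ^ 2 * ‖𝓕 w (ξ / 2 ^ n)‖) * ((2 ^ j)⁻¹ * 2 ^ n) := by
          field_simp
      _ ≤ _ := by gcongr

theorem summable_two_inv_pow_natAbs : Summable fun j : ℤ => (2 : ℝ)⁻¹ ^ j.natAbs := by
  refine Summable.of_nat_of_neg ?_ ?_ <;>
  simpa using summable_geometric_of_lt_one (r := (2 : ℝ)⁻¹) (by norm_num) (by norm_num)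

/-- The Besov norm of order `1/2` of a sum of bumps `κ_k w_k (2^{n_k} (x - x_k))` is bounded by the
sum of the amplitudes `κ_k`, whatever the scales and the positions are: the norm is invariant under
dyadic dilations and subadditive. -/
theorem exists_besovNorm_superposition_le (m : ℕ) : ∃ C : ℝ, 0 ≤ C ∧
    ∀ {ι : Type} [Countable ι] {K : ℝ} {w : ι → Fin m → ℝ → ℂ} {κ : ι → ℝ} {n : ι → ℕ}
      {x₀ : ι → ℝ} {c : Amb m} {f : ℝ → Amb m}, (∀ k, 0 ≤ κ k) → Summable κ →
      (∀ k i, Integrable (w k i)) → (∀ k i, ∫ x, ‖w k i x‖ ≤ K) → (∀ k i ξ, ‖𝓕 (w k i) ξ‖ ≤ K) →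
      (∀ k i ξ, ξ ^ 2 * ‖𝓕 (w k i) ξ‖ ≤ K) → 0 ≤ K → MemLp f ⊤ volume →
      (∀ x i, (f x i : ℂ) = c i + ∑' k, (κ k : ℂ) * w k i (2 ^ n k * (x - x₀ k))) →
      besovNorm (1 / 2) f ≤ ENNReal.ofReal (C * K * ∑' k, κ k) := by
  set S : ℝ := ∑' j : ℤ, (2 : ℝ)⁻¹ ^ j.natAbs with hS
  have hS0 : 0 ≤ S := tsum_nonneg fun j => by positivity
  refine ⟨2 * m * S, by positivity, ?_⟩
  intro ι _ K w κ n x₀ c f hκ hκs hw hw1 hw2 hw3 hK hf hfx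
  set F : ι → Fin m → ℝ → ℂ := fun k i x => (κ k : ℂ) * w k i (2 ^ n k * (x - x₀ k)) with hF
  have hscale : ∀ k i, Integrable fun x => w k i (2 ^ n k * (x - x₀ k)) := fun k i =>
    ((hw k i).comp_mul_left' (by positivity)).comp_sub_right (x₀ k)
  have hFi : ∀ k i, Integrable (F k i) := fun k i => (hscale k i).const_mul _
  have hF1 : ∀ k i, ∫ x, ‖F k i x‖ ≤ K * κ k := fun k i => by
    have e1 := integral_sub_right_eq_self (fun x => ‖w k i (2 ^ n k * x)‖) (x₀ k) (μ := volume)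
    have e2 := Measure.integral_comp_mul_left (fun x => ‖w k i x‖) (2 ^ n k)
    simp only [hF, norm_mul, Complex.norm_real, Real.norm_of_nonneg (hκ k)]
    rw [integral_const_mul, e1, e2, smul_eq_mul, abs_of_pos (by positivity), mul_comm K]
    have h0 : 0 ≤ ∫ x, ‖w k i x‖ := integral_nonneg fun x => norm_nonneg _
    have h1 : ((2 : ℝ) ^ n k)⁻¹ ≤ 1 := inv_le_one_of_one_le₀ (one_le_pow₀ (by norm_num))
    gcongr
    · exact hκ k
    · nlinarith [hw1 k i]
  have hFs : ∀ i, Summable fun k => ∫ x, ‖F k i x‖ := fun i =>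
    Summable.of_nonneg_of_le (fun k => integral_nonneg fun x => norm_nonneg _) (fun k => hF1 k i)
      (hκs.mul_left K)
  have hsumi : ∀ i, Integrable fun x => ∑' k, F k i x := fun i => by
    have hm : AEStronglyMeasurable fun x => ∑' k, F k i x := by
      have e : (fun x => ∑' k, F k i x) = fun x => (f x i : ℂ) - c i := by
        funext x; rw [hfx x i]; simp [hF]
      rw [e]
      exact (Complex.continuous_ofReal.comp_aestronglyMeasurable
        ((EuclideanSpace.proj (𝕜 := ℝ) i).continuous.comp_aestronglyMeasurable hf.1)).sub
        aestronglyMeasurable_const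
    refine ⟨hm, ?_⟩
    have hs := hFs i
    calc ∫⁻ x, ‖∑' k, F k i x‖ₑ ≤ ∫⁻ x, ∑' k, ‖F k i x‖ₑ :=
          lintegral_mono fun x => enorm_tsum_le_tsum_enorm
      _ = ∑' k, ∫⁻ x, ‖F k i x‖ₑ := lintegral_tsum fun k => (hFi k i).1.enorm
      _ = ∑' k, ENNReal.ofReal (∫ x, ‖F k i x‖) := by
          congr 1; funext k
          rw [ofReal_integral_norm_eq_lintegral_enorm (hFi k i)]
      _ = ENNReal.ofReal (∑' k, ∫ x, ‖F k i x‖) :=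
          (ENNReal.ofReal_tsum_of_nonneg (fun k => integral_nonneg fun x => norm_nonneg _) hs).symm
      _ < ⊤ := ENNReal.ofReal_lt_top
  have hfour : ∀ i ξ, ‖𝓕 (fun x => ∑' k, F k i x) ξ‖ₑ ≤ ∑' k, ‖𝓕 (F k i) ξ‖ₑ := fun i ξ => by
    have hmod : ∀ k x, ‖Complex.exp (↑(-2 * Real.pi * inner ℝ x ξ) * Complex.I) • F k i x‖
        = ‖F k i x‖ := fun k x => by
      rw [norm_smul, Complex.norm_exp_ofReal_mul_I, one_mul]
    have h := hasSum_integral_of_summable_integral_norm (μ := volume)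
      (F := fun k x => Complex.exp (↑(-2 * Real.pi * inner ℝ x ξ) * Complex.I) • F k i x)
      (fun k => by
        refine (hFi k i).congr' ?_ (Eventually.of_forall fun x => (hmod k x).symm)
        have hc : Continuous fun x : ℝ =>
            Complex.exp (↑(-2 * Real.pi * inner ℝ x ξ) * Complex.I) := by fun_prop
        exact hc.aestronglyMeasurable.smul (hFi k i).1)
      (by simpa only [hmod] using hFs i)
    rw [Real.fourier_eq']
    simp only [smul_eq_mul, tsum_mul_left] at h
    simp only [smul_eq_mul]
    rw [← h.tsum_eq]
    refine enorm_tsum_le_tsum_enorm.trans (le_of_eq ?_)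
    congr 1; funext k
    rw [Real.fourier_eq']
    simp only [smul_eq_mul]
  set B : ℤ → ℝ≥0∞ := fun j =>
    m * ∑' k, ENNReal.ofReal (K * κ k * (2 : ℝ)⁻¹ ^ (j - n k).natAbs * ((2 : ℝ) ^ j)⁻¹) with hB
  have hmain := besovNorm_half_le_tsum (B := B)
    (isFourierOffZero_of_integrable (c := c) (F := fun i x => ∑' k, F k i x) hf hsumi hfx) ?_
  · refine hmain.trans ?_
    have hterm : ∀ j : ℤ, 2 * (ENNReal.ofReal ((2 : ℝ) ^ j) * B j) =
        2 * m * ∑' k, ENNReal.ofReal (K * κ k) * ENNReal.ofReal ((2 : ℝ)⁻¹ ^ (j - n k).natAbs) :=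
      fun j => by
        rw [hB]
        simp only
        rw [mul_left_comm (ENNReal.ofReal _), ← ENNReal.tsum_mul_left, ← mul_assoc]
        congr 2; funext k
        have : 0 ≤ K * κ k := mul_nonneg hK (hκ k)
        rw [← ENNReal.ofReal_mul (by positivity), ← ENNReal.ofReal_mul this]
        congr 1
        have : (2 : ℝ) ^ j ≠ 0 := by positivity
        field_simp
    simp only [hterm]
    rw [ENNReal.tsum_mul_left, ENNReal.tsum_comm]
    have hshift : ∀ k, ∑' j : ℤ, ENNReal.ofReal ((2 : ℝ)⁻¹ ^ (j - n k).natAbs) = ENNReal.ofReal S :=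
      fun k => by
        rw [hS, ENNReal.ofReal_tsum_of_nonneg (fun j => by positivity) summable_two_inv_pow_natAbs]
        exact (Equiv.subRight (n k : ℤ)).tsum_eq
          (fun j => ENNReal.ofReal ((2 : ℝ)⁻¹ ^ j.natAbs))
    simp only [ENNReal.tsum_mul_left, hshift, ENNReal.tsum_mul_right]
    rw [← ENNReal.ofReal_tsum_of_nonneg (fun k => mul_nonneg hK (hκ k)) (hκs.mul_left K),
      tsum_mul_left, ← ENNReal.ofReal_mul (mul_nonneg hK (tsum_nonneg hκ)),
      show (2 : ℝ≥0∞) * m = ENNReal.ofReal (2 * m) by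
        rw [ENNReal.ofReal_mul (by norm_num)]; simp,
      ← ENNReal.ofReal_mul (by positivity)]
    apply ENNReal.ofReal_le_ofReal
    apply le_of_eq; ring
  · intro j ξ hξ
    have hcomp : ∀ g : EuclideanSpace ℂ (Fin m), ‖g‖ₑ ≤ ∑ i, ‖g i‖ₑ := fun g => by
      have h1 : ‖g‖ ≤ ∑ i, ‖g i‖ := by
        calc ‖g‖ = ‖∑ i, EuclideanSpace.single i (g i)‖ := by
              congr 1; ext i; simp [Pi.single_apply]
          _ ≤ ∑ i, ‖EuclideanSpace.single i (g i)‖ := norm_sum_le _ _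
          _ = _ := by simp
      rw [← ofReal_norm]
      refine (ENNReal.ofReal_le_ofReal h1).trans (le_of_eq ?_)
      rw [ENNReal.ofReal_sum_of_nonneg fun i _ => norm_nonneg _]
      simp only [ofReal_norm]
    refine (hcomp _).trans ?_
    calc _ ≤ ∑ _i : Fin m,
          ∑' k, ENNReal.ofReal (K * κ k * (2 : ℝ)⁻¹ ^ (j - n k).natAbs * ((2 : ℝ) ^ j)⁻¹) := by
          refine Finset.sum_le_sum fun i _ => (hfour i ξ).trans (ENNReal.tsum_le_tsum fun k => ?_)
          rw [← ofReal_norm]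
          apply ENNReal.ofReal_le_ofReal
          have h1 : 𝓕 (F k i) ξ = (κ k : ℂ) * 𝓕 (fun x => w k i (2 ^ n k * (x - x₀ k))) ξ := by
            rw [Real.fourier_eq', Real.fourier_eq', ← integral_const_mul]
            congr 1; funext x
            simp only [hF, smul_eq_mul]; ring
          have h2 := fourier_dilate_translate_le (hw2 k i) (hw3 k i) (x₀ k) (n k) hξ
          have hp : (0 : ℝ) < 2 ^ j := by positivity
          rw [h1, norm_mul, Complex.norm_real, Real.norm_of_nonneg (hκ k), ← div_eq_mul_inv,
            le_div_iff₀ hp]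
          have := mul_le_mul_of_nonneg_left h2 (hκ k)
          linarith
      _ = B j := by simp [hB]

/-! ### Wave maps with compactly perturbed small data and a lasting jump -/

theorem exists_fourier_bound {w : ℝ → ℝ} (hw : ContDiff ℝ ∞ w) (hc : HasCompactSupport w) :
    ∃ K : ℝ, 0 ≤ K ∧ Integrable w ∧ ∫ x, |w x| ≤ K ∧ (∀ x, |w x| ≤ K) ∧
      (∀ ξ, ‖𝓕 (fun x => (w x : ℂ)) ξ‖ ≤ K) ∧ ∀ ξ, ξ ^ 2 * ‖𝓕 (fun x => (w x : ℂ)) ξ‖ ≤ K := by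
  have hwc : ContDiff ℝ ∞ fun x => (w x : ℂ) := Complex.ofRealCLM.contDiff.comp hw
  have hcc : HasCompactSupport fun x => (w x : ℂ) := hc.comp_left (g := ((↑) : ℝ → ℂ)) (by simp)
  obtain ⟨ψ, hψ⟩ := exists_schwartz_of_hasCompactSupport hcc hwc
  obtain ⟨K₁, h₁, hK₁⟩ := ψ.decay 0 0
  obtain ⟨K₂, h₂, hK₂⟩ := (𝓕 ψ : 𝓢(ℝ, ℂ)).decay 0 0
  obtain ⟨K₃, h₃, hK₃⟩ := (𝓕 ψ : 𝓢(ℝ, ℂ)).decay 2 0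
  have hco : (ψ : ℝ → ℂ) = fun x => (w x : ℂ) := funext hψ
  simp only [pow_zero, one_mul, norm_iteratedFDeriv_zero, SchwartzMap.fourier_coe, hco,
    Real.norm_eq_abs, sq_abs, Complex.norm_real] at hK₁ hK₂ hK₃
  have h₀ : 0 ≤ ∫ x, |w x| := integral_nonneg fun x => abs_nonneg _
  refine ⟨(∫ x, |w x|) + K₁ + K₂ + K₃, by positivity,
    hw.continuous.integrable_of_hasCompactSupport hc, by linarith,
    fun x => by linarith [hK₁ x], fun ξ => by linarith [hK₂ ξ], fun ξ => by linarith [hK₃ ξ]⟩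

theorem fourier_linear_combination {w₁ w₂ : ℝ → ℝ} (h₁ : Integrable w₁) (h₂ : Integrable w₂)
    (α β ξ : ℝ) : 𝓕 (fun x => ((α * w₁ x + β * w₂ x : ℝ) : ℂ)) ξ =
      α * 𝓕 (fun x => (w₁ x : ℂ)) ξ + β * 𝓕 (fun x => (w₂ x : ℂ)) ξ := by
  have hmod : ∀ {w : ℝ → ℝ}, Integrable w → Integrable fun x : ℝ =>
      Complex.exp (↑(-2 * Real.pi * inner ℝ x ξ) * Complex.I) * (w x : ℂ) := fun {w} hw => by
    have hc : Continuous fun x : ℝ =>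
      Complex.exp (↑(-2 * Real.pi * inner ℝ x ξ) * Complex.I) := by fun_prop
    exact hw.ofReal.bdd_mul (c := 1) hc.aestronglyMeasurable
      (Eventually.of_forall fun x => by rw [Complex.norm_exp_ofReal_mul_I])
  simp only [Real.fourier_eq', smul_eq_mul]
  rw [← integral_const_mul, ← integral_const_mul,
    ← integral_add ((hmod h₁).const_mul _) ((hmod h₂).const_mul _)]
  congr 1; funext x
  push_cast; ring

theorem Orthonormal.rotate {E : Type*} [NormedAddCommGroup E] [InnerProductSpace ℝ E]
    {b : Fin 3 → E} (hb : Orthonormal ℝ b) {k d : ℝ} (hkd : k ^ 2 + d ^ 2 = 1) :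
    Orthonormal ℝ ![d • b 0 + k • b 2, b 1, (-k) • b 0 + d • b 2] := by
  have h := orthonormal_iff_ite.1 hb
  rw [orthonormal_iff_ite]
  intro i j
  fin_cases i <;> fin_cases j <;>
  simp only [Fin.zero_eta, Fin.mk_one, Fin.reduceFinMk, Matrix.cons_val, inner_add_left,
    inner_add_right, real_inner_smul_left, real_inner_smul_right, h, Fin.reduceEq, if_true,
    if_false] <;>
  norm_num only [mul_one, mul_zero, add_zero, zero_add] <;>
  first | ring1 | linear_combination hkd

/-- The wave maps underlying the whole construction. For every amplitude `κ ∈ (0, 1)`, scale `2⁻ⁿ`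
and position `x₀` there is a global smooth wave map with values in the sphere whose data are `κ`
times a bump of width `2⁻ⁿ` away from the constant `c`, the profile of the bump being bounded
independently of `κ`. The map equals `c` outside the light cone of the bump, but in the region both
waves have left its `i`-th coordinate is `q < 1 = c i`. -/
theorem exists_bump_waveMap {m : ℕ} (hm : 2 < m) :
    ∃ (K : ℝ) (c : Amb m) (i : Fin m), 0 ≤ K ∧ ‖c‖ = 1 ∧ c i = 1 ∧
    ∀ κ : ℝ, 0 < κ → κ < 1 → ∃ (w : Fin m → ℝ → ℝ) (q : ℝ), q < 1 ∧ |q| ≤ 1 ∧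
      (∀ j, Integrable (w j)) ∧ (∀ j, ∫ x, |w j x| ≤ K) ∧ (∀ j x, |w j x| ≤ K) ∧
      (∀ j ξ, ‖𝓕 (fun x => (w j x : ℂ)) ξ‖ ≤ K) ∧
      (∀ j ξ, ξ ^ 2 * ‖𝓕 (fun x => (w j x : ℂ)) ξ‖ ≤ K) ∧
      ∀ (n : ℕ) (x₀ : ℝ), ∃ φ : ℝ → ℝ → Amb m,
        ContDiff ℝ ∞ (fun p : ℝ × ℝ => φ p.1 p.2) ∧ (∀ t x, ‖φ t x‖ = 1) ∧
        (∀ x j, φ 0 x j = c j + κ * w j (2 ^ n * (x - x₀))) ∧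
        (∀ I : Set ℝ, UniqueDiffOn ℝ I → (0 : ℝ) ∈ I → IsWaveMapOn I (φ 0) φ) ∧
        (∀ t x, |t| + 1 / 2 ^ n ≤ |x - x₀| → φ t x = c) ∧
        (∀ t x, |x - x₀| ≤ t - 1 / 2 ^ n → φ t x i = q) := by
  -- the phase of the bump, which goes once around a circle as `y` goes from `0` to `1`
  set a : ℝ → ℝ := fun y => 2 * Real.pi * Real.smoothTransition y with ha
  have has : ContDiff ℝ ∞ a := contDiff_const.mul Real.smoothTransition.contDiff
  have ha0 : ∀ y ≤ 0, a y = 0 := fun y hy => by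
    simp [ha, Real.smoothTransition.zero_of_nonpos hy]
  have ha1 : ∀ y, 1 ≤ y → a y = 2 * Real.pi := fun y hy => by
    simp [ha, Real.smoothTransition.one_of_one_le hy]
  set w₁ : ℝ → ℝ := fun y => Real.cos (a y) - 1 with hw₁
  set w₂ : ℝ → ℝ := fun y => Real.sin (a y) with hw₂
  have hs₁ : ContDiff ℝ ∞ w₁ := (Real.contDiff_cos.comp has).sub contDiff_const
  have hs₂ : ContDiff ℝ ∞ w₂ := Real.contDiff_sin.comp has
  have hout : ∀ y, y ∉ Icc (0 : ℝ) 1 → w₁ y = 0 ∧ w₂ y = 0 := fun y hy => by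
    rw [mem_Icc, not_and_or, not_le, not_le] at hy
    rcases hy with hy | hy
    · simp [hw₁, hw₂, ha0 y hy.le]
    · simp [hw₁, hw₂, ha1 y hy.le]
  have hc₁ : HasCompactSupport w₁ :=
    HasCompactSupport.intro isCompact_Icc fun y hy => (hout y hy).1
  have hc₂ : HasCompactSupport w₂ :=
    HasCompactSupport.intro isCompact_Icc fun y hy => (hout y hy).2
  obtain ⟨K₁, hK₁, i₁, l₁, b₁, f₁, g₁⟩ := exists_fourier_bound hs₁ hc₁
  obtain ⟨K₂, hK₂, i₂, l₂, b₂, f₂, g₂⟩ := exists_fourier_bound hs₂ hc₂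
  set b : Fin 3 → Amb m := fun j => EuclideanSpace.single (Fin.castLE hm j) 1 with hb
  have hbo : Orthonormal ℝ b :=
    (EuclideanSpace.orthonormal_single (𝕜 := ℝ) (ι := Fin m)).comp _ (Fin.castLE_injective hm)
  set i : Fin m := Fin.castLE hm 2 with hi
  have hbi : b 0 i = 0 ∧ b 1 i = 0 ∧ b 2 i = 1 := by
    simp [hb, hi, Fin.ext_iff]
  refine ⟨K₁ + K₂, b 2, i, by positivity, hbo.1 2, hbi.2.2, fun κ hκ hκ1 => ?_⟩
  obtain ⟨s, c, d, hss, hds, hsd, hcd, hdd, hsq, hs0, hc0, hd0, hq⟩ := exists_jacobi hκ hκ1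
  have hkd : κ ^ 2 + d 0 ^ 2 = 1 := by rw [← hs0]; exact hsq 0
  rw [← hd0] at hq
  set e : Fin 3 → Amb m := ![d 0 • b 0 + κ • b 2, b 1, (-κ) • b 0 + d 0 • b 2] with he
  have heo : Orthonormal ℝ e := hbo.rotate hkd
  have hcoord : ∀ j k, |e j k| ≤ 1 := fun j k => by
    rw [← heo.1 j, ← Real.norm_eq_abs]; exact PiLp.norm_apply_le _ _
  -- the pole of the frame is chosen such that all bumps sit on the same constant `b 2`
  have hbase : κ • e 0 + d 0 • e 2 = b 2 := by
    have : κ • e 0 + d 0 • e 2 = (κ ^ 2 + d 0 ^ 2) • b 2 := by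
      simp only [he, Matrix.cons_val]; module
    rw [this, hkd, one_smul]
  have hbound : ∀ {A B p r : ℝ}, |p| ≤ 1 → |r| ≤ 1 → 0 ≤ A → 0 ≤ B → |p| * A + |r| * B ≤ A + B :=
    fun hp hr hA hB => add_le_add (mul_le_of_le_one_left hA hp) (mul_le_of_le_one_left hB hr)
  have hfour : ∀ j ξ, ‖𝓕 (fun x => ((e 0 j * w₁ x + e 1 j * w₂ x : ℝ) : ℂ)) ξ‖ ≤
      ‖𝓕 (fun x => (w₁ x : ℂ)) ξ‖ + ‖𝓕 (fun x => (w₂ x : ℂ)) ξ‖ := fun j ξ => by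
    rw [fourier_linear_combination i₁ i₂]
    refine (norm_add_le _ _).trans ?_
    rw [norm_mul, norm_mul, Complex.norm_real, Complex.norm_real, Real.norm_eq_abs,
      Real.norm_eq_abs]
    exact hbound (hcoord 0 j) (hcoord 1 j) (norm_nonneg _) (norm_nonneg _)
  have hpt : ∀ j x, |e 0 j * w₁ x + e 1 j * w₂ x| ≤ |w₁ x| + |w₂ x| := fun j x => by
    refine (abs_add_le _ _).trans ?_
    rw [abs_mul, abs_mul]
    exact hbound (hcoord 0 j) (hcoord 1 j) (abs_nonneg _) (abs_nonneg _)
  have hcomp : ∀ X Y Z j, frameComb e X Y Z j = X * e 0 j + Y * e 1 j + Z * e 2 j :=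
    fun X Y Z j => by simp [frameComb]
  have hei : e 0 i = κ ∧ e 1 i = 0 ∧ e 2 i = d 0 := by
    simp [he, hbi.1, hbi.2.1, hbi.2.2]
  have hq1 : |d 0 * d Real.pi - κ * s Real.pi| ≤ 1 := by
    rw [abs_le]
    constructor <;> nlinarith [hsq Real.pi, sq_nonneg (d 0 - d Real.pi), sq_nonneg (κ + s Real.pi),
      sq_nonneg (d 0 + d Real.pi), sq_nonneg (κ - s Real.pi)]
  refine ⟨fun j x => e 0 j * w₁ x + e 1 j * w₂ x, d 0 * d Real.pi - κ * s Real.pi, hq, hq1,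
    fun j => (i₁.const_mul _).add (i₂.const_mul _), fun j => ?_,
    fun j x => (hpt j x).trans (add_le_add (b₁ x) (b₂ x)),
    fun j ξ => (hfour j ξ).trans (add_le_add (f₁ ξ) (f₂ ξ)), fun j ξ => ?_, fun n x₀ => ?_⟩
  · calc _ ≤ ∫ x, (|w₁ x| + |w₂ x|) :=
          integral_mono ((i₁.const_mul _).add (i₂.const_mul _)).abs (i₁.abs.add i₂.abs) (hpt j)
      _ ≤ _ := by rw [integral_add i₁.abs i₂.abs]; exact add_le_add l₁ l₂
  · calc _ ≤ ξ ^ 2 * (‖𝓕 (fun x => (w₁ x : ℂ)) ξ‖ + ‖𝓕 (fun x => (w₂ x : ℂ)) ξ‖) :=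
          mul_le_mul_of_nonneg_left (hfour j ξ) (sq_nonneg ξ)
      _ ≤ _ := by rw [mul_add]; exact add_le_add (g₁ ξ) (g₂ ξ)
  · set α : ℝ → ℝ := fun y => a (2 ^ n * (y - x₀)) with hα
    have hαs : ContDiff ℝ ∞ α := has.comp (by fun_prop)
    have hp : (0 : ℝ) < 2 ^ n := by positivity
    have hα0 : ∀ y, y ≤ x₀ → α y = 0 := fun y hy =>
      ha0 _ (mul_nonpos_of_nonneg_of_nonpos hp.le (by linarith))
    have hα1 : ∀ y, x₀ + 1 / 2 ^ n ≤ y → α y = 2 * Real.pi := fun y hy => ha1 _ (by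
      have : 1 / 2 ^ n ≤ y - x₀ := by linarith
      rwa [div_le_iff₀ hp, mul_comm] at this)
    have hpi : (0 : ℝ) < 1 / 2 ^ n := by positivity
    refine ⟨revolutionMap e s d α, contDiff_revolutionMap e hss hds hαs,
      fun t x => norm_revolutionMap heo hsq α t x, fun x j => ?_,
      fun I hI h0 => isWaveMapOn_revolutionMap hsd hcd hdd heo hss hds hsq hc0 hαs hI h0,
      fun t x htx => ?_, fun t x htx => ?_⟩
    · have h2 : b 2 j = κ * e 0 j + d 0 * e 2 j := by rw [← hbase]; simp
      simp only [revolutionMap, add_zero, sub_zero, sub_self, zero_div, hs0, add_self_div_two,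
        hcomp, h2, hw₁, hw₂, hα]
      ring
    · have : (α (x + t) = 0 ∧ α (x - t) = 0) ∨
          (α (x + t) = 2 * Real.pi ∧ α (x - t) = 2 * Real.pi) := by
        have ht1 := le_abs_self t
        have ht2 := neg_abs_le t
        rcases le_total x x₀ with hx | hx
        · rw [abs_of_nonpos (a := x - x₀) (by linarith)] at htx
          exact Or.inl ⟨hα0 _ (by linarith), hα0 _ (by linarith)⟩
        · rw [abs_of_nonneg (a := x - x₀) (by linarith)] at htx
          exact Or.inr ⟨hα1 _ (by linarith), hα1 _ (by linarith)⟩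
      rcases this with ⟨h1, h2⟩ | ⟨h1, h2⟩
      · simp [revolutionMap, h1, h2, frameComb, hs0, hbase]
      · simp [revolutionMap, h1, h2, frameComb, hs0, hbase]
    · -- between the two waves the null phases differ by a full turn, so that `τ = σ = π`
      have htx' := abs_le.1 htx
      have h1 : α (x + t) = 2 * Real.pi := hα1 _ (by linarith [htx'.1])
      have h2 : α (x - t) = 0 := hα0 _ (by linarith [htx'.2])
      simp only [revolutionMap, h1, h2, sub_zero, add_zero,
        mul_div_cancel_left₀ Real.pi two_ne_zero,
        Real.cos_pi, Real.sin_pi, hcomp, hei.1, hei.2.1, hei.2.2]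
      ring

/-! ### Failure of continuity of the solution operator at constant data -/

/-- The norm of a function with the profile of the waves emitted by a bump: it takes one value at
distance less than `t` from `x₀`, another at distances between `t` and `2 t`, and the transition has
width `2⁻ⁿ`. -/
theorem exists_le_hDotNorm_of_waves : ∃ A : ℝ, 0 < A ∧
    ∀ {m : ℕ} {f : ℝ → Amb m} {i : Fin m} {M p q x₀ t : ℝ} {n l : ℕ}, 1 ≤ l →
      2 / 2 ^ n ≤ t / 2 ^ l → (∀ᵐ x, ‖f x‖ ≤ M) → |p| ≤ M → |q| ≤ M →
      (∀ x, |x - x₀| ≤ t - 1 / 2 ^ n → f x i = p) →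
      (∀ x, t + 1 / 2 ^ n ≤ |x - x₀| → |x - x₀| ≤ 2 * t → f x i = q) →
      ENNReal.ofReal (A * |q - p| * √l - M) ≤ hDotNorm (1 / 2) f := by
  obtain ⟨A, hA, h⟩ := exists_le_hDotNorm_of_jump
  refine ⟨A, hA, ?_⟩
  intro m f i M p q x₀ t n l hl hnl hM hpM hqM hp hq
  set ε : ℝ := 1 / 2 ^ n with hε
  have hε0 : 0 < ε := by positivity
  have h2ε : 2 * ε ≤ t / 2 ^ l := by
    rw [hε]; linarith [show (2 : ℝ) / 2 ^ n = 2 * (1 / 2 ^ n) by ring]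
  have hl2 : (2 : ℝ) ≤ 2 ^ l := by
    calc (2 : ℝ) = 2 ^ 1 := by norm_num
      _ ≤ 2 ^ l := pow_le_pow_right₀ (by norm_num) hl
  have ht : 0 < t := by
    have : 0 < t / 2 ^ l := by linarith
    exact (div_pos_iff_of_pos_right (by positivity)).1 this
  have htl : t / 2 ^ l ≤ t / 2 := by gcongr
  refine h (x₁ := x₀ + t - ε) (r := t) ht hl hM hpM hqM (fun x hx => hp x ?_) fun x hx => hq x ?_ ?_
  · rw [abs_le]; constructor <;> linarith [hx.1, hx.2]
  · rw [abs_of_nonneg (by linarith [hx.1])]; linarith [hx.1]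
  · rw [abs_of_nonneg (by linarith [hx.1])]; linarith [hx.2]

theorem isWaveMapOn_const {m : ℕ} (c : Amb m) {I : Set ℝ} (hI : UniqueDiffOn ℝ I)
    (h0 : (0 : ℝ) ∈ I) : IsWaveMapOn I (fun _ => c) (fun _ _ => c) :=
  isWaveMapOn_of_hasDerivAt (φt := fun _ _ => 0) (φx := fun _ _ => 0) (φtt := fun _ _ => 0)
    (φxx := fun _ _ => 0) contDiff_const (fun t _ => hasDerivAt_const t c)
    (fun _ x => hasDerivAt_const x c) (fun t _ => hasDerivAt_const t 0)
    (fun _ x => hasDerivAt_const x 0) (fun _ _ => by simp) (fun _ => rfl) hI h0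

theorem besovNorm_const {m : ℕ} (c : Amb m) : besovNorm (1 / 2) (fun _ => c) = 0 := by
  obtain ⟨C, -, hC⟩ := exists_besovNorm_superposition_le m
  have := hC (ι := Empty) (K := 0) (w := fun _ _ _ => 0) (κ := fun _ => 0) (n := fun _ => 0)
    (x₀ := fun _ => 0) (c := c) (f := fun _ => c) (fun k => k.elim) summable_empty
    (fun k => k.elim) (fun k => k.elim) (fun k => k.elim) (fun k => k.elim) le_rfl
    (memLp_top_const c) (fun x i => by simp)
  simpa using this

theorem norm_le_of_coord_le {m : ℕ} {v : Amb m} {B : ℝ} (h : ∀ j, |v j| ≤ B) : ‖v‖ ≤ m * B := by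
  calc ‖v‖ = ‖∑ j, EuclideanSpace.single j (v j)‖ := by
        congr 1; ext j; simp [Pi.single_apply]
    _ ≤ ∑ j, ‖EuclideanSpace.single j (v j)‖ := norm_sum_le _ _
    _ ≤ ∑ _j : Fin m, B := Finset.sum_le_sum fun j _ => by simpa using h j
    _ = _ := by simp

/-- Well-posedness fails in every norm between `Ḣ^{1/2}` and `Ḃ^{1/2,1}_2`. Bumps of small
amplitude `κ` are close to the constant data, uniformly in the scale `2⁻ⁿ`, whereas at time `T` the
distance of their evolution to the constant solution tends to infinity with `n`. -/
theorem not_smallDataWellPosed {m : ℕ} (hm : 2 < m) {N : (ℝ → Amb m) → ℝ≥0∞}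
    (hlow : ∀ f, hDotNorm (1 / 2) f ≤ 2 * N f) (hup : ∀ f, N f ≤ 2 * besovNorm (1 / 2) f) :
    ¬ SmallDataWellPosed m N := by
  rintro ⟨δ, hδ, T, hT, S, -, hcont, hclass⟩
  obtain ⟨K, c, i, hK, hc1, hci, hbump⟩ := exists_bump_waveMap hm
  obtain ⟨C, hC0, hC⟩ := exists_besovNorm_superposition_le m
  obtain ⟨A, hA, hjump⟩ := exists_le_hDotNorm_of_waves
  have huniq : UniqueDiffOn ℝ (Icc 0 T) := uniqueDiffOn_Icc hT
  have h0T : (0 : ℝ) ∈ Icc 0 T := ⟨le_rfl, hT.le⟩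
  have hTT : T ∈ Icc 0 T := ⟨hT.le, le_rfl⟩
  have hNc : N (fun _ => c) = 0 := by
    have := hup fun _ => c
    rw [besovNorm_const, mul_zero] at this
    exact le_antisymm this zero_le
  have hcmem : (fun _ : ℝ => c) ∈ smallData N δ := ⟨measurable_const, fun _ => hc1, by rwa [hNc]⟩
  have hSc : S (fun _ => c) T =ᵐ[volume] fun _ => c :=
    hclass _ hcmem contDiff_const ⟨0, c, fun _ _ => rfl⟩ _ (isWaveMapOn_const c huniq h0T) T hTT
  obtain ⟨ρ, hρ, hball⟩ := hcont _ hcmem 1 one_pos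
  -- the amplitude
  set D : ℝ := 2 * (C * K) + 2 * (m * K) + 1 with hD
  have hD0 : 0 < D := by positivity
  obtain ⟨ν, hν0, hν⟩ := ENNReal.lt_iff_exists_nnreal_btwn.1 (lt_min hδ hρ)
  have hν0' : (0 : ℝ) < ν := by exact_mod_cast hν0
  set κ : ℝ := min (1 / 2) (ν / D) with hκ
  have hκ0 : 0 < κ := lt_min (by norm_num) (div_pos hν0' hD0)
  have hκ1 : κ < 1 := (min_le_left _ _).trans_lt (by norm_num)
  have hκD : D * κ ≤ ν := by
    have := min_le_right (1 / 2 : ℝ) (ν / D)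
    rw [← hκ, le_div_iff₀ hD0] at this
    linarith
  have hDmin : ENNReal.ofReal (D * κ) < min δ ρ :=
    (ENNReal.ofReal_le_ofReal hκD).trans_lt (by simpa using hν)
  obtain ⟨w, q, hq, hq1, hw1, hw2, hw3, hw4, hw5, hφ⟩ := hbump κ hκ0 hκ1
  -- the scale
  obtain ⟨n₀, hn₀⟩ := exists_pow_lt_of_lt_one (show 0 < T / 2 by positivity)
    (show (1 / 2 : ℝ) < 1 by norm_num)
  obtain ⟨l, hl⟩ := exists_nat_gt ((8 / (A * (1 - q))) ^ 2)
  have hAq : 0 < A * (1 - q) := mul_pos hA (by linarith)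
  have hl1 : 1 ≤ l := by
    rcases Nat.eq_zero_or_pos l with h | h
    · rw [h] at hl
      have : (0 : ℝ) ≤ (8 / (A * (1 - q))) ^ 2 := sq_nonneg _
      simp only [Nat.cast_zero] at hl
      linarith
    · exact h
  have hsl : 8 < A * (1 - q) * √l := by
    have := Real.lt_sqrt_of_sq_lt hl
    rwa [div_lt_iff₀ hAq, mul_comm] at this
  obtain ⟨φ, hφs, hφ1, hφ0, hφw, hφc, hφq⟩ := hφ (n₀ + l) 0
  have hφ0s : ContDiff ℝ ∞ (φ 0) := hφs.comp (contDiff_const.prodMk contDiff_id)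
  have hmem : MemLp (φ 0) ⊤ volume := memLp_top_of_bound hφ0s.continuous.aestronglyMeasurable 1
    (Eventually.of_forall fun x => (hφ1 0 x).le)
  have hbes : ∀ (c' : Amb m) (f : ℝ → Amb m), MemLp f ⊤ volume →
      (∀ x j, f x j = c' j + κ * w j (2 ^ (n₀ + l) * (x - 0))) →
      N f ≤ ENNReal.ofReal (2 * (C * K) * κ) := fun c' f hf hfx => by
    have h1 := hC (ι := Unit) (K := K) (w := fun _ j x => (w j x : ℂ)) (κ := fun _ => κ)
      (n := fun _ => n₀ + l) (x₀ := fun _ => 0) (c := c') (f := f) (fun _ => hκ0.le)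
      (hasSum_fintype _).summable (fun _ j => (hw1 j).ofReal)
      (fun _ j => by simpa using hw2 j) (fun _ j ξ => hw4 j ξ) (fun _ j ξ => hw5 j ξ) hK hf
      (fun x j => by simp [hfx x j])
    refine (hup f).trans ?_
    calc 2 * besovNorm (1 / 2) f ≤ 2 * ENNReal.ofReal (C * K * ∑' _ : Unit, κ) := by gcongr
      _ = _ := by
        rw [mul_assoc 2 (C * K) κ, ENNReal.ofReal_mul (p := 2) (by norm_num), tsum_fintype]
        simp
  have hmeml : φ 0 ∈ smallData N δ := by
    refine ⟨hφ0s.continuous.measurable, hφ1 0, ?_⟩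
    refine (hbes c _ hmem hφ0).trans_lt (lt_of_le_of_lt ?_ (hDmin.trans_le (min_le_left _ _)))
    apply ENNReal.ofReal_le_ofReal
    gcongr
    rw [hD]
    have : 0 ≤ (m : ℝ) * K := by positivity
    linarith
  have hdist : critDist N (φ 0) (fun _ => c) < ρ := by
    refine lt_of_le_of_lt ?_ (hDmin.trans_le (min_le_right _ _))
    have hd1 : N (φ 0 - fun _ => c) ≤ ENNReal.ofReal (2 * (C * K) * κ) :=
      hbes 0 _ (hmem.sub (memLp_top_const c)) fun x j => by simp [hφ0 x j]
    have hd2 : eLpNorm (φ 0 - fun _ => c) 2 (volume.restrict (Icc (-1) 1)) ≤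
        ENNReal.ofReal (2 * (m * K) * κ) := by
      refine (eLpNorm_le_of_ae_bound (C := m * (κ * K)) (Eventually.of_forall fun x => ?_)).trans ?_
      · refine norm_le_of_coord_le fun j => ?_
        simp only [Pi.sub_apply, PiLp.sub_apply, hφ0 x j, add_sub_cancel_left, abs_mul,
          abs_of_pos hκ0]
        exact mul_le_mul_of_nonneg_left (hw3 j _) hκ0.le
      · have hv : (volume.restrict (Icc (-1 : ℝ) 1)) univ ^ ((2 : ℝ≥0∞).toReal⁻¹) ≤ 2 := by
          rw [Measure.restrict_apply_univ, Real.volume_Icc]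
          norm_num
          calc (2 : ℝ≥0∞) ^ (1 / 2 : ℝ) ≤ 2 ^ (1 : ℝ) :=
                ENNReal.rpow_le_rpow_of_exponent_le (by norm_num) (by norm_num)
            _ = 2 := by simp
        calc _ ≤ 2 * ENNReal.ofReal (m * (κ * K)) := by gcongr
          _ = ENNReal.ofReal (2 * (m * K) * κ) := by
              rw [show 2 * (m * K) * κ = 2 * (m * (κ * K)) by ring,
                ENNReal.ofReal_mul (by norm_num)]
              simp
    calc critDist N (φ 0) (fun _ => c)
        ≤ ENNReal.ofReal (2 * (C * K) * κ) + ENNReal.ofReal (2 * (m * K) * κ) :=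
          add_le_add hd1 hd2
      _ = ENNReal.ofReal (2 * (C * K) * κ + 2 * (m * K) * κ) :=
          (ENNReal.ofReal_add (by positivity) (by positivity)).symm
      _ ≤ ENNReal.ofReal (D * κ) := by
          apply ENNReal.ofReal_le_ofReal
          rw [hD]; nlinarith
  have hp0 : (0 : ℝ) < 1 / 2 ^ (n₀ + l) := by positivity
  have hSφ : S (φ 0) T =ᵐ[volume] φ T := by
    refine hclass _ hmeml hφ0s ⟨1 / 2 ^ (n₀ + l), c, fun x hx => hφc 0 x ?_⟩ φ
      (hφw _ huniq h0T) T hTT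
    simpa using hx
  have hle := (le_self_add).trans (hball _ hmeml hdist T hTT)
  have hH : hDotNorm (1 / 2) (φ T - fun _ => c) ≤ 2 := by
    rw [← hDotNorm_congr_ae (hSφ.sub hSc)]
    refine (hlow _).trans ?_
    calc 2 * N (S (φ 0) T - S (fun _ => c) T) ≤ 2 * 1 := by gcongr
      _ = 2 := mul_one 2
  have hlower := hjump (f := φ T - fun _ => c) (i := i) (M := 2) (p := q - 1) (q := 0) (x₀ := 0)
    (t := T) (n := n₀ + l) (l := l) hl1 ?_ (Eventually.of_forall fun x => ?_) ?_ (by simp)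
    (fun x hx => by simp [hφq T x hx, hci])
    (fun x hx _ => by
      have := hφc T x (by rwa [abs_of_pos hT])
      simp [this])
  · have h2 : A * |0 - (q - 1)| * √l - 2 = A * (1 - q) * √l - 2 := by
      rw [show (0 : ℝ) - (q - 1) = 1 - q by ring, abs_of_pos (by linarith)]
    rw [h2] at hlower
    have h3 := hlower.trans hH
    rw [show (2 : ℝ≥0∞) = ENNReal.ofReal 2 by simp,
      ENNReal.ofReal_le_ofReal_iff (by norm_num)] at h3
    linarith
  · rw [pow_add, ← div_div]
    gcongr
    rw [one_div, inv_pow] at hn₀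
    rw [div_eq_mul_inv]; linarith
  · calc ‖φ T x - c‖ ≤ ‖φ T x‖ + ‖c‖ := norm_sub_le _ _
      _ = 2 := by rw [hφ1, hc1]; norm_num
  · rw [abs_le] at hq1 ⊢
    constructor <;> linarith [hq1.1]

/-! ### Smooth data with infinitely many bumps -/

theorem three_mul_four_pow_le_abs_sub {j k : ℕ} (h : j ≠ k) :
    3 * (4 : ℝ) ^ k ≤ |(4 : ℝ) ^ (j + 1) - 4 ^ (k + 1)| := by
  have hk : (4 : ℝ) ^ (k + 1) = 4 * 4 ^ k := by rw [pow_succ]; ring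
  have hp : (0 : ℝ) < 4 ^ k := by positivity
  rcases lt_or_gt_of_ne h with h | h
  · have h1 : (4 : ℝ) ^ (j + 1) ≤ 4 ^ k := pow_le_pow_right₀ (by norm_num) h
    rw [abs_sub_comm, abs_of_nonneg (by linarith)]
    linarith
  · have h1 : (4 : ℝ) ^ (k + 2) ≤ 4 ^ (j + 1) := pow_le_pow_right₀ (by norm_num) (by omega)
    have h2 : (4 : ℝ) ^ (k + 2) = 16 * 4 ^ k := by rw [pow_add]; ring
    rw [abs_of_nonneg (by linarith)]
    linarith

/-- Superposition of the deviations of the functions `φ k` from the constant `c`. -/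
noncomputable def glue {m : ℕ} (c : Amb m) (φ : ℕ → ℝ → ℝ → Amb m) (t x : ℝ) : Amb m :=
  c + ∑' k, (φ k t x - c)

theorem glue_eq {m : ℕ} {c : Amb m} {φ : ℕ → ℝ → ℝ → Amb m} {t x : ℝ} {k : ℕ}
    (h : ∀ j ≠ k, φ j t x = c) : glue c φ t x = φ k t x := by
  rw [glue, tsum_eq_single k fun j hj => by rw [h j hj, sub_self]]
  abel

section Glue

variable {m : ℕ} {c : Amb m} {φ : ℕ → ℝ → ℝ → Amb m} {n : ℕ → ℕ}
  (hn : ∀ k, 1 ≤ n k)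
  (hout : ∀ k t x, |t| + 1 / 2 ^ n k ≤ |x - 4 ^ (k + 1)| → φ k t x = c)

include hn in
theorem inv_two_pow_le_half (k : ℕ) : (1 : ℝ) / 2 ^ n k ≤ 1 / 2 := by
  have h : (2 : ℝ) ^ 1 ≤ 2 ^ n k := pow_le_pow_right₀ (by norm_num) (hn k)
  rw [pow_one] at h
  gcongr

include hn hout in
/-- Locally in space and for short times at most one of the waves is present. -/
theorem exists_forall_ne_eq (x₀ : ℝ) :
    ∃ k, ∀ t x, |t| < 1 / 2 → |x - x₀| < 1 / 4 → ∀ j ≠ k, φ j t x = c := by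
  have hfar : ∀ j t x, |t| < 1 / 2 → 1 ≤ |x - 4 ^ (j + 1)| → φ j t x = c := fun j t x ht hx =>
    hout j t x (by linarith [inv_two_pow_le_half hn j])
  by_cases h : ∃ k : ℕ, |x₀ - 4 ^ (k + 1)| < 5 / 4
  · obtain ⟨k, hk⟩ := h
    refine ⟨k, fun t x ht hx j hj => hfar j t x ht ?_⟩
    have h1 := three_mul_four_pow_le_abs_sub hj
    have h2 : (1 : ℝ) ≤ 4 ^ k := one_le_pow₀ (by norm_num)
    have h3 : |(4 : ℝ) ^ (j + 1) - 4 ^ (k + 1)| ≤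
        |x - 4 ^ (j + 1)| + |x - x₀| + |x₀ - 4 ^ (k + 1)| := by
      calc |(4 : ℝ) ^ (j + 1) - 4 ^ (k + 1)|
          = |-(x - 4 ^ (j + 1)) + (x - x₀) + (x₀ - 4 ^ (k + 1))| := by ring_nf
        _ ≤ |-(x - 4 ^ (j + 1))| + |x - x₀| + |x₀ - 4 ^ (k + 1)| := abs_add_three _ _ _
        _ = _ := by rw [abs_neg]
    linarith
  · push Not at h
    refine ⟨0, fun t x ht hx j _ => hfar j t x ht ?_⟩
    have h1 := h j
    have h3 : |x₀ - 4 ^ (j + 1)| ≤ |x - x₀| + |x - 4 ^ (j + 1)| := by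
      calc |x₀ - 4 ^ (j + 1)| = |-(x - x₀) + (x - 4 ^ (j + 1))| := by ring_nf
        _ ≤ |-(x - x₀)| + |x - 4 ^ (j + 1)| := abs_add_le _ _
        _ = _ := by rw [abs_neg]
    linarith

include hn hout in
theorem glue_eventuallyEq {k : ℕ} {x : ℝ} (hx : |x - 4 ^ (k + 1)| ≤ 2 * 4 ^ k) :
    glue c φ 0 =ᶠ[𝓝 x] φ k 0 := by
  filter_upwards [Metric.ball_mem_nhds x (show (0 : ℝ) < 1 / 4 by norm_num)] with y hy
  rw [Metric.mem_ball, Real.dist_eq] at hy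
  refine glue_eq fun j hj => hout j 0 y ?_
  rw [abs_zero, zero_add]
  refine (inv_two_pow_le_half hn j).trans ?_
  have h1 := three_mul_four_pow_le_abs_sub hj
  have h2 : (1 : ℝ) ≤ 4 ^ k := one_le_pow₀ (by norm_num)
  have h3 : |(4 : ℝ) ^ (j + 1) - 4 ^ (k + 1)| ≤
      |y - 4 ^ (j + 1)| + |y - x| + |x - 4 ^ (k + 1)| := by
    calc |(4 : ℝ) ^ (j + 1) - 4 ^ (k + 1)|
        = |-(y - 4 ^ (j + 1)) + (y - x) + (x - 4 ^ (k + 1))| := by ring_nf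
      _ ≤ |-(y - 4 ^ (j + 1))| + |y - x| + |x - 4 ^ (k + 1)| := abs_add_three _ _ _
      _ = _ := by rw [abs_neg]
  linarith

variable (hsm : ∀ k, ContDiff ℝ ∞ (fun p : ℝ × ℝ => φ k p.1 p.2))

include hn hout hsm in
theorem contDiffOn_glue :
    ContDiffOn ℝ ∞ (fun p : ℝ × ℝ => glue c φ p.1 p.2) (Ioo (-(1 / 2)) (1 / 2) ×ˢ univ) := by
  rintro ⟨t, x⟩ ⟨ht, -⟩
  obtain ⟨k, hk⟩ := exists_forall_ne_eq hn hout x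
  refine ((hsm k).contDiffAt.congr_of_eventuallyEq ?_).contDiffWithinAt
  filter_upwards [prod_mem_nhds (Ioo_mem_nhds ht.1 ht.2)
    (Metric.ball_mem_nhds x (show (0 : ℝ) < 1 / 4 by norm_num))] with p hp
  exact glue_eq (hk p.1 p.2 (abs_lt.2 hp.1) (by rw [← Real.dist_eq]; exact hp.2))

include hn hout hsm in
theorem contDiff_glue_zero : ContDiff ℝ ∞ (glue c φ 0) := by
  rw [← contDiffOn_univ]
  exact (contDiffOn_glue hn hout hsm).comp (contDiff_const.prodMk contDiff_id).contDiffOn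
    fun x _ => ⟨by norm_num, mem_univ _⟩

include hn hout hsm in
theorem isWaveMapOn_glue
    (hw : ∀ k, IsWaveMapOn (Ioo (-(1 / 2)) (1 / 2)) (φ k 0) (φ k)) :
    IsWaveMapOn (Ioo (-(1 / 2)) (1 / 2)) (glue c φ 0) (glue c φ) := by
  have hloc : ∀ x, ∃ k, ∀ t ∈ Ioo (-(1 / 2) : ℝ) (1 / 2), glue c φ t =ᶠ[𝓝 x] φ k t ∧
      EqOn (fun r => glue c φ r x) (fun r => φ k r x) (Ioo (-(1 / 2)) (1 / 2)) := fun x => by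
    obtain ⟨k, hk⟩ := exists_forall_ne_eq hn hout x
    refine ⟨k, fun t ht => ⟨?_, fun r hr => glue_eq (hk r x (abs_lt.2 hr) (by simp))⟩⟩
    filter_upwards [Metric.ball_mem_nhds x (show (0 : ℝ) < 1 / 4 by norm_num)] with y hy
    exact glue_eq (hk t y (abs_lt.2 ht) (by rw [← Real.dist_eq]; exact hy))
  refine ⟨(contDiffOn_infty.1 (contDiffOn_glue hn hout hsm)) 2, fun t ht x => ?_, rfl, fun x => ?_⟩
  · obtain ⟨k, hk⟩ := hloc x
    obtain ⟨h1, h2⟩ := hk t ht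
    rw [iteratedDerivWithin_congr h2 ht, derivWithin_congr h2 (h2 ht), h1.iteratedDeriv_eq,
      h1.deriv_eq, h1.self_of_nhds]
    exact (hw k).equation t ht x
  · obtain ⟨k, hk⟩ := hloc x
    have h0 : (0 : ℝ) ∈ Ioo (-(1 / 2) : ℝ) (1 / 2) := by norm_num
    have h2 := (hk 0 h0).2
    rw [derivWithin_congr h2 (h2 h0)]
    exact (hw k).velocity x

end Glue

/-- In a proof that the norm is infinite the function may be taken essentially bounded: the norm of
any other function is infinite by definition. -/
theorem hDotNorm_eq_top_of_forall {m : ℕ} {f : ℝ → Amb m}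
    (h : ∀ M : ℝ, 1 ≤ M → (∀ᵐ x, ‖f x‖ ≤ M) →
      ∀ᶠ k : ℕ in atTop, ENNReal.ofReal (k - M) ≤ hDotNorm (1 / 2) f) :
    hDotNorm (1 / 2) f = ⊤ := by
  by_cases hb : MemLp f ⊤ volume
  · obtain ⟨M, hM⟩ : ∃ M : ℝ, ∀ᵐ x, ‖f x‖ ≤ M := by
      refine ⟨(eLpNorm f ⊤ volume).toReal, ?_⟩
      filter_upwards [ae_le_eLpNormEssSup (f := f) (μ := volume)] with x hx
      rw [← eLpNorm_exponent_top] at hx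
      rw [← toReal_enorm]
      exact ENNReal.toReal_mono hb.2.ne hx
    have h1 := h (max M 1) (le_max_right _ _) (hM.mono fun x hx => hx.trans (le_max_left _ _))
    refine top_le_iff.1 (le_of_tendsto ?_ h1)
    exact ENNReal.tendsto_ofReal_atTop.comp
      (tendsto_atTop_add_const_right _ _ tendsto_natCast_atTop_atTop)
  · exact iInf₂_eq_top.2 fun g hg => absurd hg.bounded hb

/-! ### Instantaneous blow-up, and conclusion -/

/-- Data consisting of infinitely many bumps of summable amplitudes at distances tending to
infinity, the width of the `k`-th bump being so small that its evolution has norm at least `k - 1`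
at all times which are not very small. By finite speed of propagation no other bump interferes
before a time of order `4ᵏ`. -/
theorem exists_instant_blowup {m : ℕ} (hm : 2 < m) {ε : ℝ} (hε : 0 < ε) :
    ∃ f : ℝ → Amb m, ContDiff ℝ ∞ f ∧ (∀ x, ‖f x‖ = 1) ∧
      besovNorm (1 / 2) f ≤ ENNReal.ofReal (ε / 2) ∧
      (∃ τ : ℝ, 0 < τ ∧ ∃ φ : ℝ → ℝ → Amb m,
        ContDiffOn ℝ ∞ (fun p : ℝ × ℝ => φ p.1 p.2) (Ioo (-τ) τ ×ˢ univ) ∧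
        (∀ t ∈ Ioo (-τ) τ, ∀ x, ‖φ t x‖ = 1) ∧ IsWaveMapOn (Ioo (-τ) τ) f φ) ∧
      ∀ (T : ℝ) (ψ : ℝ → ℝ → Amb m), 0 < T → IsForwardWaveMap T f ψ →
        hDotNorm (1 / 2) (ψ T) = ⊤ := by
  obtain ⟨K, c, i, hK, hc1, hci, hbump⟩ := exists_bump_waveMap hm
  obtain ⟨C, hC0, hC⟩ := exists_besovNorm_superposition_le m
  obtain ⟨A, hA, hjump⟩ := exists_le_hDotNorm_of_waves
  have hCK : 0 < C * K + 1 := by positivity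
  set θ : ℝ := min (1 / 2) (ε / (4 * (C * K + 1))) with hθ
  have hθ0 : 0 < θ := lt_min (by norm_num) (by positivity)
  have hθ1 : θ ≤ 1 / 2 := min_le_left _ _
  have hθε : 4 * (C * K + 1) * θ ≤ ε := by
    have := min_le_right (1 / 2 : ℝ) (ε / (4 * (C * K + 1)))
    rw [← hθ, le_div_iff₀ (by positivity)] at this
    linarith
  set κ : ℕ → ℝ := fun k => θ * (1 / 2) ^ k with hκ
  have hκ0 : ∀ k, 0 < κ k := fun k => by positivity
  have hκ1 : ∀ k, κ k < 1 := fun k => by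
    have : (1 / 2 : ℝ) ^ k ≤ 1 := pow_le_one₀ (by norm_num) (by norm_num)
    simp only [hκ]; nlinarith
  have hκs : Summable κ := summable_geometric_two.mul_left θ
  have hκsum : ∑' k, κ k = θ * 2 := by rw [tsum_mul_left, tsum_geometric_two]
  choose w q hq hq1 hw1 hw2 hw3 hw4 hw5 hφ using fun k => hbump (κ k) (hκ0 k) (hκ1 k)
  -- the number `l k` of dyadic scales needed for the norm to exceed `k`
  have hl : ∀ k : ℕ, ∃ l : ℕ, 1 ≤ l ∧ (k : ℝ) ≤ A * |1 - q k| * √l := fun k => by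
    have hAq : 0 < A * |1 - q k| := mul_pos hA (abs_pos.2 (by linarith [hq k]))
    obtain ⟨l, hl⟩ := exists_nat_ge ((k / (A * |1 - q k|)) ^ 2)
    refine ⟨l + 1, by omega, ?_⟩
    have : k / (A * |1 - q k|) ≤ √((l + 1 : ℕ) : ℝ) := by
      apply Real.le_sqrt_of_sq_le
      push_cast; linarith
    rwa [div_le_iff₀ hAq, mul_comm] at this
  choose l hl1 hlk using hl
  -- the summand `k + 1` leaves room for `l k` dyadic scales below any fixed time, for large `k`
  set n : ℕ → ℕ := fun k => l k + (k + 1) with hn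
  have hn1 : ∀ k, 1 ≤ n k := fun k => by simp only [hn]; omega
  choose φ hφs hφ1 hφ0 hφw hφc hφq using fun k => hφ k (n k) (4 ^ (k + 1))
  set f : ℝ → Amb m := glue c φ 0 with hf
  have hfs : ContDiff ℝ ∞ f := contDiff_glue_zero hn1 hφc hφs
  have hnorm : ∀ t ∈ Ioo (-(1 / 2) : ℝ) (1 / 2), ∀ x, ‖glue c φ t x‖ = 1 := fun t ht x => by
    obtain ⟨k, hk⟩ := exists_forall_ne_eq hn1 hφc x
    rw [glue_eq (hk t x (abs_lt.2 ht) (by simp)), hφ1]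
  have hf1 : ∀ x, ‖f x‖ = 1 := hnorm 0 (by norm_num)
  refine ⟨f, hfs, hf1, ?_, ⟨1 / 2, by norm_num, glue c φ, contDiffOn_glue hn1 hφc hφs, hnorm,
    isWaveMapOn_glue hn1 hφc hφs fun k => hφw k _ isOpen_Ioo.uniqueDiffOn (by norm_num)⟩, ?_⟩
  · have hfx : ∀ x j, (f x j : ℂ) =
        c j + ∑' k, (κ k : ℂ) * (w k j (2 ^ n k * (x - 4 ^ (k + 1))) : ℂ) := fun x j => by
      obtain ⟨k, hk⟩ := exists_forall_ne_eq hn1 hφc x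
      have hk0 := hk 0 x (by norm_num) (by simp)
      rw [hf, glue_eq hk0, hφ0 k x j, tsum_eq_single k fun a ha => ?_]
      · push_cast; rfl
      · have := hφ0 a x j
        rw [hk0 a ha] at this
        have h0 : κ a * w a j (2 ^ n a * (x - 4 ^ (a + 1))) = 0 := by linarith
        exact_mod_cast h0
    have := hC (ι := ℕ) (K := K) (w := fun k j x => (w k j x : ℂ)) (κ := κ) (n := n)
      (x₀ := fun k => 4 ^ (k + 1)) (c := c) (f := f) (fun k => (hκ0 k).le) hκs
      (fun k j => (hw1 k j).ofReal) (fun k j => by simpa using hw2 k j) hw4 hw5 hK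
      (memLp_top_of_bound hfs.continuous.aestronglyMeasurable 1
        (Eventually.of_forall fun x => (hf1 x).le)) hfx
    refine this.trans (ENNReal.ofReal_le_ofReal ?_)
    rw [hκsum]
    nlinarith
  · intro T ψ hT hψ
    refine hDotNorm_eq_top_of_forall fun M hM1 hM => ?_
    have h4 : Tendsto (fun k : ℕ => (4 : ℝ) ^ k) atTop atTop :=
      tendsto_pow_atTop_atTop_of_one_lt (by norm_num)
    have h2 : Tendsto (fun k : ℕ => (1 / 2 : ℝ) ^ k) atTop (𝓝 0) :=
      tendsto_pow_atTop_nhds_zero_of_lt_one (by norm_num) (by norm_num)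
    filter_upwards [h4.eventually_ge_atTop (2 * T), h2.eventually_le_const hT] with k hk4 hk2
    -- near the `k`-th bump the solution is the one emitted by that bump alone
    have hloc : ∀ x, |x - 4 ^ (k + 1)| ≤ 2 * 4 ^ k - T → ψ T x = φ k T x :=
      hψ.eq_of_eventuallyEq hT
        ((hφw k _ (uniqueDiffOn_Icc hT) ⟨le_rfl, hT.le⟩).isForwardWaveMap hT subset_rfl)
        (fun x hx => glue_eventuallyEq hn1 hφc hx) T ⟨hT.le, le_rfl⟩
    have hp : (0 : ℝ) < 1 / 2 ^ n k := by positivity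
    have := hjump (f := ψ T) (i := i) (M := M) (p := q k) (q := 1) (x₀ := 4 ^ (k + 1)) (t := T)
      (n := n k) (l := l k) (hl1 k) ?_ hM ((hq1 k).trans hM1) (by simpa using hM1)
      (fun x hx => by rw [hloc x (by linarith), hφq k T x hx])
      (fun x hx hx' => by
        rw [hloc x (by linarith), hφc k T x (by rwa [abs_of_pos hT]), hci])
    · refine le_trans (ENNReal.ofReal_le_ofReal ?_) this
      linarith [hlk k]
    · simp only [hn]
      have e : (2 : ℝ) / 2 ^ (l k + (k + 1)) = (1 / 2) ^ k / 2 ^ l k := by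
        rw [pow_add, pow_succ, one_div, inv_pow]
        field_simp
      rw [e]
      gcongr

theorem mainTheorem2 (m : ℕ) (hm : 2 < m) :
    ¬ SmallDataWellPosed m (hDotNorm (1 / 2)) ∧
    ¬ SmallDataWellPosed m (besovNorm (1 / 2)) ∧
    ∀ ε : ℝ, 0 < ε → ∃ f : ℝ → Amb m,
      ContDiff ℝ ∞ f ∧ (∀ x, ‖f x‖ = 1) ∧
      besovNorm (1 / 2) f ≤ ENNReal.ofReal ε ∧ hDotNorm (1 / 2) f ≤ ENNReal.ofReal ε ∧
      (∃ τ : ℝ, 0 < τ ∧ ∃ φ : ℝ → ℝ → Amb m,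
        ContDiffOn ℝ ∞ (fun p : ℝ × ℝ => φ p.1 p.2) (Ioo (-τ) τ ×ˢ univ) ∧
        (∀ t ∈ Ioo (-τ) τ, ∀ x, ‖φ t x‖ = 1) ∧
        IsWaveMapOn (Ioo (-τ) τ) f φ) ∧
      ∀ I : Set ℝ, I.OrdConnected → I.Nontrivial → (0 : ℝ) ∈ I →
        ∀ φ : ℝ → ℝ → Amb m, IsWaveMapOn I f φ →
          ∀ t ∈ I, t ≠ 0 → hDotNorm (1 / 2) (φ t) = ⊤ ∧ besovNorm (1 / 2) (φ t) = ⊤ := by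
  have hle2 : ∀ a : ℝ≥0∞, a ≤ 2 * a := fun a => le_mul_of_one_le_left zero_le (by norm_num)
  refine ⟨not_smallDataWellPosed hm (fun f => hle2 _) hDotNorm_half_le_besovNorm,
    not_smallDataWellPosed hm hDotNorm_half_le_besovNorm (fun f => hle2 _), fun ε hε => ?_⟩
  obtain ⟨f, hfs, hf1, hfb, hex, htop⟩ := exists_instant_blowup hm hε
  have hb2 : 2 * besovNorm (1 / 2) f ≤ ENNReal.ofReal ε := by
    calc 2 * besovNorm (1 / 2) f ≤ 2 * ENNReal.ofReal (ε / 2) := by gcongr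
      _ = ENNReal.ofReal (2 * (ε / 2)) := by rw [ENNReal.ofReal_mul (by norm_num)]; simp
      _ = ENNReal.ofReal ε := by congr 1; ring
  refine ⟨f, hfs, hf1, (hle2 _).trans hb2, (hDotNorm_half_le_besovNorm f).trans hb2, hex,
    fun I hI _ h0 φ hφ t ht ht0 => ?_⟩
  have hH : hDotNorm (1 / 2) (φ t) = ⊤ := by
    rcases lt_or_gt_of_ne ht0 with h | h
    · have := htop (-t) _ (by linarith) (hφ.isForwardWaveMap_neg (T := -t) (by linarith)
        (by rw [neg_neg]; exact hI.out ht h0))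
      rwa [neg_neg] at this
    · exact htop t φ h (hφ.isForwardWaveMap h (hI.out h0 ht))
  refine ⟨hH, ?_⟩
  have := hDotNorm_half_le_besovNorm (φ t)
  rw [hH, top_le_iff] at this
  by_contra hne
  exact ENNReal.mul_ne_top (by norm_num) hne this
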